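/- Fix reals $0\le b<a$. For an even number $n=2m$ let $V=\{1,\dots,n\}$, let $r_s=\frac{a\log n}{n}$ and $r_d=\frac{b\log n}{n}$ ($\log$ is the natural logarithm), and let $V=V_1\sqcup V_2$ with $|V_1|=|V_2|=n/2$. Let the locations $X_u$, $u\in V$, be independent and uniform on $[0,1]$, and put $d(u,v)=\min\{|X_u-X_v|,\,1-|X_u-X_v|\}$. In the geometric block model graph $G\sim{\rm GBM}(r_s,r_d)$, distinct vertices $u,v$ in the same part are adjacent iff $d(u,v)\le r_s$, and vertices $u,v$ in different parts are adjacent iff $d(u,v)\le r_d$. A recovery algorithm receives $G$ and all locations $(X_u)_{u\in V}$, may be randomized, and outputs a partition of $V$ into two unnamed parts; its output is correct if it equals $\{V_1,V_2\}$. All asymptotics are for $n=2m\to\infty$. 1. If $a-b<1/2$ or $a<1$, then every recovery algorithm (any measurable procedure, which may depend on $n,a,b$, with no restriction on its running time) gives incorrect output with probability $1-o(1)$, where the partition $\{V_1,V_2\}$ is uniformly random among all partitions of $V$ into two parts of size $n/2$ and independent of the locations, and the probability is over the partition, the locations and the randomness of the algorithm. 2. If $a-b>1/2$ and $a>1$,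 then exact recovery is possible: there is a deterministic measurable recovery algorithm which, for every choice of the balanced partitions $\{V_1,V_2\}$ (one for each $n$), has correct output with probability $1-o(1)$ over the locations. One such algorithm is the following. Give the first vertex the label $+$. Whenever a vertex $u$ has a label and $v\neq u$ satisfies $r_d\le d(u,v)\le r_s$, give $v$ the label of $u$ if $uv$ is an edge of $G$, and the opposite label if it is not. Repeat this exhaustively, and output the set of vertices that receive the label $+$ as one part and its complement as the other. -/

import Mathlib

open MeasureTheory ProbabilityTheory Filter Topology

namespace GeometricBlock

noncomputable section

/-- The circular distance `min {|x - y|, 1 - |x - y|}` on `[0,1]`. -/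
def circDist (x y : ℝ) : ℝ := min |x - y| (1 - |x - y|)

/-- The joint law of the locations of `n` vertices: independent and uniform on `[0,1]`. -/
def locationLaw (n : ℕ) : Measure (Fin n → ℝ) :=
  Measure.pi fun _ => (volume : Measure ℝ).restrict (Set.Icc 0 1)

/-- The radius `c * log n / n` (natural logarithm). -/
def radius (c : ℝ) (n : ℕ) : ℝ := c * Real.log n / n

/-- The geometric block model graph with parts `V₁` and `V₁ᶜ`, connection radius `rs` inside a part
and `rd` across parts, at the locations `x`. -/
def gbm {n : ℕ} (rs rd : ℝ) (V₁ : Finset (Fin n)) (x : Fin n → ℝ) : SimpleGraph (Fin n) where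
  Adj u v := u ≠ v ∧
    (((u ∈ V₁ ↔ v ∈ V₁) ∧ circDist (x u) (x v) ≤ rs) ∨
      (¬ (u ∈ V₁ ↔ v ∈ V₁) ∧ circDist (x u) (x v) ≤ rd))
  symm := ⟨by
    intro u v h
    simpa only [ne_eq, eq_comm, iff_comm, circDist, abs_sub_comm] using h⟩
  loopless := ⟨fun _ h => h.1 rfl⟩

/-- The vertex-random graph with connectivity interval `[r₁, r₂]` at the locations `x`. -/
def vrg {n : ℕ} (r₁ r₂ : ℝ) (x : Fin n → ℝ) : SimpleGraph (Fin n) where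
  Adj u v := u ≠ v ∧ r₁ ≤ circDist (x u) (x v) ∧ circDist (x u) (x v) ≤ r₂
  symm := ⟨by
    intro u v h
    simpa only [ne_eq, eq_comm, circDist, abs_sub_comm] using h⟩
  loopless := ⟨fun _ h => h.1 rfl⟩

/-- A (possibly randomized) recovery procedure on `n` vertices: it receives the graph and the
locations of all vertices, and outputs (with a law depending on the input) one part of a partition
of the vertices into two parts. No computational restriction is imposed. Procedures are meant to be
Markov kernels, which is required where they are quantified over. -/
abbrev Algorithm (n : ℕ) : Type :=
  Kernel (SimpleGraph (Fin n) × (Fin n → ℝ)) (Finset (Fin n))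

/-- The outputs that name the partition `{V₁, V₁ᶜ}`; parts carry no names. -/
def correct {n : ℕ} (V₁ : Finset (Fin n)) : Set (Finset (Fin n)) := {V₁, V₁ᶜ}

/-- The probability, over the locations and the internal randomness of `A`, that `A` recovers the
partition `{V₁, V₁ᶜ}` exactly from the graph and the locations. -/
def successProb {n : ℕ} (rs rd : ℝ) (A : Algorithm n) (V₁ : Finset (Fin n)) : ENNReal :=
  ∫⁻ x, A (gbm rs rd V₁ x, x) (correct V₁) ∂(locationLaw n)

/-- The probability that the output of `A` is incorrect when the partition is `{V₁, V₁ᶜ}`. -/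
def errorProb {n : ℕ} (rs rd : ℝ) (A : Algorithm n) (V₁ : Finset (Fin n)) : ENNReal :=
  ∫⁻ x, A (gbm rs rd V₁ x, x) (correct V₁)ᶜ ∂(locationLaw n)

/-- The probability that the output of `A` is incorrect when the partition of the `2 * m` vertices
into two parts of size `m` is uniformly random and independent of the locations. -/
def averageErrorProb {m : ℕ} (rs rd : ℝ) (A : Algorithm (2 * m)) : ENNReal :=
  (∑ V₁ ∈ Finset.powersetCard m (Finset.univ : Finset (Fin (2 * m))), errorProb rs rd A V₁) /
    ((Finset.powersetCard m (Finset.univ : Finset (Fin (2 * m)))).card : ENNReal)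

/-- `Propagated G H v c`: starting from the label `true` at the first vertex and moving along edges
of `H`, where a pair is read as lying in the same part if it is an edge of `G` and in different
parts if it is not, the vertex `v` can receive the label `c`. -/
inductive Propagated {n : ℕ} (G H : SimpleGraph (Fin n)) : Fin n → Bool → Prop
  | root (u : Fin n) (hu : u.val = 0) : Propagated G H u true
  | same (u v : Fin n) (c : Bool) (hu : Propagated G H u c) (hH : H.Adj u v) (hG : G.Adj u v) :
      Propagated G H v c
  | diff (u v : Fin n) (c : Bool) (hu : Propagated G H u c) (hH : H.Adj u v) (hG : ¬ G.Adj u v) :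
      Propagated G H v (!c)

open Classical in
/-- The set of vertices that receive the label of the first vertex. -/
def propagatedPart {n : ℕ} (G H : SimpleGraph (Fin n)) : Finset (Fin n) :=
  Finset.univ.filter fun v => Propagated G H v true

theorem measurable_circDist {n : ℕ} (u v : Fin n) :
    Measurable fun x : Fin n → ℝ => circDist (x u) (x v) := by
  unfold circDist
  fun_prop

theorem measurable_vrg {n : ℕ} (r₁ r₂ : ℝ) :
    Measurable fun x : Fin n → ℝ => vrg r₁ r₂ x := by
  rw [SimpleGraph.measurable_iff_adj]
  intro u v
  refine Measurable.and measurable_const (Measurable.and ?_ ?_)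
  · exact measurableSet_setOfPred.1 (measurableSet_le measurable_const (measurable_circDist u v))
  · exact measurableSet_setOfPred.1 (measurableSet_le (measurable_circDist u v) measurable_const)

instance (n : ℕ) : MeasurableSingletonClass (SimpleGraph (Fin n)) := by
  refine ⟨fun G => ⟨{G.Adj}, measurableSet_singleton _, ?_⟩⟩
  ext H
  exact ⟨fun h => SimpleGraph.ext h, fun h => congrArg SimpleGraph.Adj h⟩

theorem measurable_propagatedPart {n : ℕ} (rs rd : ℝ) :
    Measurable fun p : SimpleGraph (Fin n) × (Fin n → ℝ) =>
      propagatedPart p.1 (vrg rd rs p.2) := by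
  have h : Measurable fun p : SimpleGraph (Fin n) × (Fin n → ℝ) => (p.1, vrg rd rs p.2) :=
    measurable_fst.prodMk ((measurable_vrg rd rs).comp measurable_snd)
  have hf : Measurable fun q : SimpleGraph (Fin n) × SimpleGraph (Fin n) =>
      propagatedPart q.1 q.2 := measurable_of_countable _
  exact hf.comp h

/-- The deterministic procedure that reads off whether two vertices lie in the same part or in
different parts for all pairs at distance in `[rd, rs]`, and propagates these readings from the
first vertex. It uses the graph, the locations and the two radii only. -/
def propagation {n : ℕ} (rs rd : ℝ) : Algorithm n :=
  Kernel.deterministic (fun p => propagatedPart p.1 (vrg rd rs p.2))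
    (measurable_propagatedPart rs rd)

instance {n : ℕ} (rs rd : ℝ) : IsMarkovKernel (propagation (n := n) rs rd) := by
  unfold propagation
  infer_instance

end

end GeometricBlock

/-! Both halves are governed by the graph `vrg rd rs`. Its edges are, up to ties at distance exactly
`rd`, the pairs whose adjacency in the block model reveals whether they lie in the same part; every
other pair carries no information.

Possibility. On a connected `vrg`, propagation recovers the partition. To prove connectedness,
unroll the circle onto the line and suppose that two consecutive points at gap `g` lie in different
components. A point at distance in `[b, a]` from both would join them, so on either side of the pair
an interval of length `a - b - g` is empty. Unless the empty intervals nearby already have total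
length at least `2 * (a - b)`, there is another consecutive pair in different components, and if the
empty length in a window is at most `τ < 2 * (a - b)`, its gap is smaller by at least `2 * (a - b) -
τ`. Infinite descent is absurd (`rel_of_short_empty_intervals`). For random points, a fixed set of
measure `(1 + δ) * log n / n` is empty with probability about `n ^ (-1 - δ)`, and a grid of mesh of
order `log n / n` leaves only `O(n)` sets to exclude (`locationLaw_exists_empty_cells_le`).

Impossibility. Flipping all labels in a component of `vrg` does not change the block graph. With `K`
components, at most `2 ^ (n - K)` graphs arise from all `2 ^ n` label sets, so at most `2 * 2 ^ (n -
K)` label sets can be answered correctly in total, whereas there are at least `2 ^ n / n` balanced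
ones (`one_sub_le_averageErrorProb`). It remains to find about `4 * log n` components. If `a - b < 1
/ 2` there are many isolated vertices; if `a < 1` there are many gaps longer than `rs`, which cut
the circle into arcs. Both are vertices with no other vertex at a relative position in a set of
measure `β * log n / n` with `β < 1`, and their number is bounded below by the second moment method
(`tendsto_lonelyCount`). -/

namespace GeometricBlock

/-! ### Connectedness of a discrete point set on the line -/

/-- Among finitely many points of an interval with endpoints that are not related there are two
consecutive points that are not related. -/
theorem exists_consecutive_not_rel {ι : Type*} (pos : ι → ℝ) (R : ι → ι → Prop)
    (hR : Equivalence R) (hfin : ∀ s t : ℝ, {i | s ≤ pos i ∧ pos i ≤ t}.Finite)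
    {i j : ι} (hij : pos i ≤ pos j) (hn : ¬ R i j) :
    ∃ p q, ¬ R p q ∧ pos i ≤ pos p ∧ pos p ≤ pos q ∧ pos q ≤ pos j ∧
      ∀ k, ¬ (pos p < pos k ∧ pos k < pos q) := by
  set S : Set (ι × ι) := {x | ¬ R x.1 x.2 ∧ pos i ≤ pos x.1 ∧ pos x.1 ≤ pos x.2 ∧ pos x.2 ≤ pos j}
    with hS
  have hSf : S.Finite := by
    refine ((hfin (pos i) (pos j)).prod (hfin (pos i) (pos j))).subset ?_
    rintro ⟨p, q⟩ ⟨-, h1, h2, h3⟩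
    exact ⟨⟨h1, h2.trans h3⟩, ⟨h1.trans h2, h3⟩⟩
  -- In an unrelated pair of least gap, an intermediate point would by transitivity be unrelated to
  -- one of the two ends and give a smaller gap.
  obtain ⟨⟨p, q⟩, ⟨h0, h1, h2, h3⟩, hmin⟩ :=
    hSf.exists_minimalFor (fun x => pos x.2 - pos x.1) S ⟨(i, j), hn, le_rfl, hij, le_rfl⟩
  refine ⟨p, q, h0, h1, h2, h3, fun k ⟨hk1, hk2⟩ => ?_⟩
  by_cases hpk : R p k
  · have hkq : ¬ R k q := fun h => h0 (hR.trans hpk h)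
    have := hmin (j := (k, q)) ⟨hkq, h1.trans hk1.le, hk2.le, h3⟩
    simp only at this
    have := this (by linarith)
    linarith
  · have := hmin (j := (p, k)) ⟨hpk, h1, hk1.le, hk2.le.trans h3⟩
    simp only at this
    have := this (by linarith)
    linarith

/-- A discrete point set on the line is connected by the pairs at distance in `[b, a]` if intervals
in a window of length `2 * a` that contain no points have total length at most `τ`, where `τ < a`
and `τ < 2 * (a - b)`. -/
theorem rel_of_short_empty_intervals {ι : Type*} (pos : ι → ℝ) (R : ι → ι → Prop)
    (hR : Equivalence R) (hfin : ∀ s t : ℝ, {i | s ≤ pos i ∧ pos i ≤ t}.Finite)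
    {a b τ : ℝ} (hτ : 0 ≤ τ) (hτa : τ < a) (hτb : τ < 2 * (a - b))
    (hadj : ∀ i j, b ≤ pos j - pos i → pos j - pos i ≤ a → R i j)
    (hE : ∀ c₁ d₁ c₂ d₂ c₃ d₃ c₄ d₄ : ℝ, c₁ ≤ d₁ → d₁ ≤ c₂ → c₂ ≤ d₂ → d₂ ≤ c₃ → c₃ ≤ d₃ →
      d₃ ≤ c₄ → c₄ ≤ d₄ → d₄ ≤ c₁ + 2 * a →
      (∀ i, ¬ (c₁ < pos i ∧ pos i < d₁)) → (∀ i, ¬ (c₂ < pos i ∧ pos i < d₂)) →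
      (∀ i, ¬ (c₃ < pos i ∧ pos i < d₃)) → (∀ i, ¬ (c₄ < pos i ∧ pos i < d₄)) →
      (d₁ - c₁) + (d₂ - c₂) + (d₃ - c₃) + (d₄ - c₄) ≤ τ)
    (i j : ι) : R i j := by
  by_contra hij
  have triv : ∀ c : ℝ, ∀ i, ¬ (c < pos i ∧ pos i < c) := fun c i h => by linarith [h.1, h.2]
  set P : ℝ → Prop := fun g => ∃ u v, ¬ R u v ∧ pos u ≤ pos v ∧ pos v - pos u ≤ g ∧
    ∀ k, ¬ (pos u < pos k ∧ pos k < pos v) with hP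
  have step : ∀ g, P g → P (g - (2 * (a - b) - τ)) := by
    rintro g ⟨u, v, huv, hle, hg, hempty⟩
    set x := pos u with hx
    set y := pos v with hy
    have hya : y - x ≤ τ := by
      by_contra hcon
      push Not at hcon
      -- Truncation at `x + a` keeps the interval in the window, and it is still longer than `τ`
      -- because `τ < a`. Degenerate intervals fill the three unused slots.
      set z := min y (x + a) with hz
      have hz1 : z ≤ y := min_le_left _ _
      have hz2 : z ≤ x + a := min_le_right _ _
      have hz3 : x + τ < z := lt_min (by linarith) (by linarith)
      have := hE x z z z z z z z (by linarith) le_rfl le_rfl le_rfl le_rfl le_rfl le_rfl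
        (by linarith) (fun k hk => hempty k ⟨hk.1, hk.2.trans_le hz1⟩) (triv z) (triv z) (triv z)
      linarith
    have hyb : y - x < b := by
      by_contra hcon
      push Not at hcon
      exact huv (hadj u v hcon (by linarith))
    -- The length of the overlap of `[x + b, x + a]` and `[y + b, y + a]`, and of its mirror image
    -- on the left. A point in an overlap would be related to both `u` and `v`.
    set e := max 0 (a - b - (y - x)) with he
    have he0 : 0 ≤ e := le_max_left _ _
    have he1 : a - b - (y - x) ≤ e := le_max_right _ _
    have he2 : e ≤ a - b := max_le (by linarith) (by linarith)
    have he3 : 0 < e → e = a - b - (y - x) := by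
      intro h
      rcases max_choice 0 (a - b - (y - x)) with h' | h'
      · rw [← he] at h'; linarith
      · exact h'
    have he4 : y - a + e ≤ x := by
      rcases he0.eq_or_lt with h | h
      · linarith
      · linarith [he3 h]
    have hright : ∀ k, ¬ (x + a - e < pos k ∧ pos k < x + a) := by
      rintro k ⟨hk1, hk2⟩
      have h := he3 (by linarith)
      exact huv (hR.trans (hadj u k (by linarith) (by linarith))
        (hR.symm (hadj v k (by linarith) (by linarith))))
    have hleft : ∀ k, ¬ (y - a < pos k ∧ pos k < y - a + e) := by
      rintro k ⟨hk1, hk2⟩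
      have h := he3 (by linarith)
      exact huv (hR.trans (hR.symm (hadj k u (by linarith) (by linarith)))
        (hadj k v (by linarith) (by linarith)))
    -- Otherwise the empty intervals have total length `(a - b) + (y - x) + e`, which is at least `2
    -- * (a - b) > τ`.
    obtain ⟨w, hw1, hw2⟩ : ∃ w, x + b < pos w ∧ pos w < x + a - e := by
      by_contra hcon
      push Not at hcon
      have := hE (y - a) (y - a + e) x y (x + b) (x + a - e) (x + a - e) (x + a)
        (by linarith) he4 hle (by linarith) (by linarith) le_rfl (by linarith) (by linarith)
        hleft hempty (fun k hk => absurd hk.2 (not_lt.2 (hcon k hk.1))) hright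
      linarith
    have huw : R u w := hadj u w (by linarith) (by linarith)
    have hvw : ¬ R v w := fun h => huv (hR.trans huw (hR.symm h))
    obtain ⟨p, q, hpq, hvp, hpq', hqw, hpqe⟩ :=
      exists_consecutive_not_rel pos R hR hfin (i := v) (j := w) (by linarith) hvw
    refine ⟨p, q, hpq, hpq', ?_, hpqe⟩
    -- This gives `2 * e + (y - x) + (pos q - pos p) ≤ τ`. With `e ≥ a - b - (y - x)` the new gap is
    -- at most `(y - x) - (2 * (a - b) - τ)`.
    have := hE (y - a) (y - a + e) x y (pos p) (pos q) (x + a - e) (x + a)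
        (by linarith) he4 hle hvp hpq' (by linarith) (by linarith) (by linarith)
        hleft hempty hpqe hright
    linarith
  obtain ⟨g, hg⟩ : ∃ g, P g := by
    rcases le_total (pos i) (pos j) with h | h
    · obtain ⟨p, q, h0, h1, h2, h3, h4⟩ := exists_consecutive_not_rel pos R hR hfin h hij
      exact ⟨pos q - pos p, p, q, h0, h2, le_rfl, h4⟩
    · obtain ⟨p, q, h0, h1, h2, h3, h4⟩ :=
        exists_consecutive_not_rel pos R hR hfin h (fun h => hij (hR.symm h))
      exact ⟨pos q - pos p, p, q, h0, h2, le_rfl, h4⟩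
  have iter : ∀ n : ℕ, P (g - n * (2 * (a - b) - τ)) := by
    intro n
    induction n with
    | zero => simpa using hg
    | succ n ih =>
      have := step _ ih
      convert this using 1
      push_cast; ring
  obtain ⟨n, hn⟩ := exists_nat_gt (g / (2 * (a - b) - τ))
  rw [div_lt_iff₀ (by linarith)] at hn
  obtain ⟨u, v, -, h1, h2, -⟩ := iter n
  linarith

/-! ### From the circle to the line, and from intervals to grid cells -/

/-- The cell of the grid of mesh `1 / M` on the circle that contains `y`. -/
noncomputable def cell (M : ℕ) (y : ℝ) : ZMod M := ((⌊(M : ℝ) * y⌋ : ℤ) : ZMod M)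

/-- The interval `(c, d)` contains at least `M * (d - c) - 2` cells of mesh `1 / M`. -/
theorem card_cells_ge (c d : ℝ) :
    d - c - 2 ≤ ((Finset.Ioc ⌊c⌋ (⌊d⌋ - 1)).card : ℝ) := by
  rw [Int.card_Ioc]
  have h1 : ((⌊d⌋ - 1 - ⌊c⌋ : ℤ) : ℝ) ≤ (((⌊d⌋ - 1 - ⌊c⌋).toNat : ℤ) : ℝ) := by
    exact_mod_cast Int.self_le_toNat _
  push_cast at h1
  have := Int.lt_floor_add_one d
  have := Int.floor_le c
  linarith

theorem circDist_eq_of_lift {y z : ℝ} (hy : y ∈ Set.Icc (0 : ℝ) 1) (hz : z ∈ Set.Icc (0 : ℝ) 1)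
    (k : ℤ) (h : |z + k - y| < 1 / 2) : circDist y z = |z + k - y| := by
  obtain ⟨hy0, hy1⟩ := hy
  obtain ⟨hz0, hz1⟩ := hz
  have h1 := abs_lt.1 h
  have hk1 : (k : ℝ) < 2 := by linarith
  have hk2 : (-2 : ℝ) < k := by linarith
  have hk1' : k < 2 := by exact_mod_cast hk1
  have hk2' : -2 < k := by exact_mod_cast hk2
  unfold circDist
  obtain rfl | rfl | rfl : k = -1 ∨ k = 0 ∨ k = 1 := by omega
  · push_cast at *
    rw [abs_of_nonpos (by linarith : y - z ≤ 0), abs_of_nonpos (by linarith : z + -1 - y ≤ 0),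
      min_eq_right (by linarith)]
    ring
  · push_cast at *
    rw [add_zero] at *
    rw [abs_sub_comm y z, min_eq_left (by linarith)]
  · push_cast at *
    rw [abs_of_nonneg (by linarith : 0 ≤ y - z), abs_of_nonneg (by linarith : 0 ≤ z + 1 - y),
      min_eq_right (by linarith)]
    ring

/-- If every collection of at least `N` cells in a window of `K` cells contains a location, then the
vertex-random graph is connected. -/
theorem vrg_reachable_of_cells {n : ℕ} (x : Fin n → ℝ) (hx : ∀ u, x u ∈ Set.Icc (0 : ℝ) 1)
    {r₁ r₂ τ : ℝ} (h₁ : 0 ≤ r₁) (h₂ : r₂ < 1 / 2) (hτ : 0 ≤ τ) (hτ₂ : τ < r₂)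
    (hτ₁ : τ < 2 * (r₂ - r₁)) {M K : ℕ} {N : ℝ} (hM : 0 < M) (hK : 2 * r₂ * M ≤ K)
    (hN : N ≤ M * τ - 8)
    (hcell : ∀ s : ℤ, ∀ T ⊆ Finset.Ico (0 : ℤ) K, N ≤ T.card →
      ∃ u, ∃ t ∈ T, cell M (x u) = ((s + t : ℤ) : ZMod M))
    (u v : Fin n) : (vrg r₁ r₂ x).Reachable u v := by
  have hM' : (0 : ℝ) < M := by exact_mod_cast hM
  -- The circle is unrolled: vertex `u` has the lifts `x u + k`, and two lifts are related when
  -- their vertices are in the same component.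
  have key := rel_of_short_empty_intervals (ι := Fin n × ℤ) (fun i => x i.1 + i.2)
    (fun i j => (vrg r₁ r₂ x).Reachable i.1 j.1)
    ⟨fun i => SimpleGraph.Reachable.refl _, fun h => h.symm, fun h h' => h.trans h'⟩
    ?_ hτ hτ₂ hτ₁ ?_ ?_ (u, 0) (v, 0)
  · exact key
  · intro s t
    refine (Set.finite_univ.prod (Set.finite_Icc ⌊s - 1⌋ ⌈t⌉)).subset ?_
    rintro ⟨u, k⟩ ⟨h, h'⟩
    have := hx u
    refine ⟨Set.mem_univ _, ?_, ?_⟩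
    · have h1 : ((⌊s - 1⌋ : ℤ) : ℝ) ≤ k := by
        have := Int.floor_le (s - 1)
        simp only at h
        linarith [(hx u).2]
      exact_mod_cast h1
    · have h1 : (k : ℝ) ≤ ((⌈t⌉ : ℤ) : ℝ) := by
        have := Int.le_ceil t
        simp only at h'
        linarith [(hx u).1]
      exact_mod_cast h1
  · rintro ⟨u, k⟩ ⟨v, l⟩ h h'
    simp only at h h' ⊢
    by_cases huv : u = v
    · rw [huv]
    · have h3 : x v + ((l - k : ℤ) : ℝ) - x u = x v + l - (x u + k) := by push_cast; ring
      have h4 : |x v + ((l - k : ℤ) : ℝ) - x u| = x v + l - (x u + k) := by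
        rw [h3, abs_of_nonneg (by linarith)]
      have h5 := circDist_eq_of_lift (hx u) (hx v) (l - k) (by rw [h4]; linarith)
      rw [h4] at h5
      exact SimpleGraph.Adj.reachable ⟨huv, by rw [h5]; exact h, by rw [h5]; exact h'⟩
  · intro c₁ d₁ c₂ d₂ c₃ d₃ c₄ d₄ h1 h2 h3 h4 h5 h6 h7 hw e1 e2 e3 e4
    by_contra hcon
    push Not at hcon
    have hmono : ∀ {y z : ℝ}, y ≤ z → ⌊M * y⌋ ≤ ⌊M * z⌋ := fun h =>
      Int.floor_le_floor (by gcongr)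
    set C : ℝ → ℝ → Finset ℤ := fun c d => Finset.Ioc ⌊M * c⌋ (⌊M * d⌋ - 1) with hC
    have hdisj : ∀ {c d c' d' : ℝ}, d ≤ c' → Disjoint (C c d) (C c' d') := by
      intro c d c' d' h
      rw [Finset.disjoint_left]
      intro j hj hj'
      have := hmono h
      rw [hC, Finset.mem_Ioc] at hj hj'
      omega
    set U := ((C c₁ d₁ ∪ C c₂ d₂) ∪ C c₃ d₃) ∪ C c₄ d₄ with hU
    have hcard : U.card = (C c₁ d₁).card + (C c₂ d₂).card + (C c₃ d₃).card + (C c₄ d₄).card := by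
      rw [hU, Finset.card_union_of_disjoint, Finset.card_union_of_disjoint,
        Finset.card_union_of_disjoint (hdisj h2)]
      · exact Finset.disjoint_union_left.2 ⟨hdisj (by linarith), hdisj h4⟩
      · exact Finset.disjoint_union_left.2 ⟨Finset.disjoint_union_left.2
          ⟨hdisj (by linarith), hdisj (by linarith)⟩, hdisj h6⟩
    -- Each of the four intervals loses at most two cells to rounding, which accounts for the `8`.
    have hUcard : N ≤ (U.card : ℝ) := by
      rw [hcard]
      push_cast
      have g1 := card_cells_ge (M * c₁) (M * d₁)
      have g2 := card_cells_ge (M * c₂) (M * d₂)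
      have g3 := card_cells_ge (M * c₃) (M * d₃)
      have g4 := card_cells_ge (M * c₄) (M * d₄)
      have g5 := mul_lt_mul_of_pos_left hcon hM'
      simp only [hC]
      linarith
    set s : ℤ := ⌊M * c₁⌋ + 1 with hs
    have hsub : (U.image fun j => j - s) ⊆ Finset.Ico (0 : ℤ) K := by
      intro t ht
      obtain ⟨j, hj, rfl⟩ := Finset.mem_image.1 ht
      have b1 : s ≤ j ∧ j ≤ ⌊M * d₄⌋ - 1 := by
        have m1 := hmono h1
        have m2 := hmono h2
        have m3 := hmono h3
        have m4 := hmono h4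
        have m5 := hmono h5
        have m6 := hmono h6
        have m7 := hmono h7
        simp only [hU, Finset.mem_union, hC, Finset.mem_Ioc] at hj
        omega
      have b2 : (⌊M * d₄⌋ : ℝ) - (⌊M * c₁⌋ + 1) ≤ K := by
        have := Int.floor_le (M * d₄)
        have := Int.lt_floor_add_one (M * c₁)
        have := mul_le_mul_of_nonneg_left hw hM'.le
        linarith
      have b3 : ⌊M * d₄⌋ - s ≤ K := by exact_mod_cast b2
      rw [Finset.mem_Ico]
      omega
    have hcard' : N ≤ ((U.image fun j => j - s).card : ℝ) := by
      rw [Finset.card_image_of_injective _ (sub_left_injective)]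
      exact hUcard
    obtain ⟨u, t, ht, hut⟩ := hcell s _ hsub hcard'
    obtain ⟨j, hj, rfl⟩ := Finset.mem_image.1 ht
    rw [add_sub_cancel, cell, ZMod.intCast_eq_intCast_iff_dvd_sub] at hut
    obtain ⟨k, hk⟩ := hut
    have hjk : (j : ℝ) = ⌊M * x u⌋ + M * k := by
      have : j = ⌊M * x u⌋ + M * k := by linarith
      exact_mod_cast this
    have f1 := Int.floor_le (M * x u)
    have f2 := Int.lt_floor_add_one (M * x u)
    have hin : ∀ {c d : ℝ}, j ∈ C c d → c < x u + k ∧ x u + k < d := by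
      intro c d hcd
      rw [hC, Finset.mem_Ioc, Int.floor_lt] at hcd
      have f3 : ((j + 1 : ℤ) : ℝ) ≤ M * d := Int.le_floor.1 (by omega)
      push_cast at f3
      constructor
      · refine lt_of_mul_lt_mul_left (a := (M : ℝ)) ?_ hM'.le
        linarith [hcd.1]
      · refine lt_of_mul_lt_mul_left (a := (M : ℝ)) ?_ hM'.le
        linarith
    simp only [hU, Finset.mem_union] at hj
    rcases hj with ((hj | hj) | hj) | hj
    · exact e1 (u, k) (hin hj)
    · exact e2 (u, k) (hin hj)
    · exact e3 (u, k) (hin hj)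
    · exact e4 (u, k) (hin hj)

/-! ### Probability that many cells are empty -/

/-- The uniform law on `[0, 1]`. -/
noncomputable abbrev unif : Measure ℝ := (volume : Measure ℝ).restrict (Set.Icc 0 1)

instance : IsProbabilityMeasure unif := ⟨by simp [unif]⟩

instance (n : ℕ) : IsProbabilityMeasure (locationLaw n) := by
  unfold locationLaw
  infer_instance

theorem ae_mem_Icc (n : ℕ) : ∀ᵐ x ∂(locationLaw n), ∀ u, x u ∈ Set.Icc (0 : ℝ) 1 := by
  rw [ae_all_iff]
  intro u
  exact (Measure.tendsto_eval_ae_ae (i := u)).eventually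
    (ae_restrict_mem measurableSet_Icc : ∀ᵐ y ∂unif, y ∈ Set.Icc (0 : ℝ) 1)

theorem measurable_cell (M : ℕ) : Measurable (cell M) := by
  have h : Measurable fun y : ℝ => ⌊(M : ℝ) * y⌋ := Int.measurable_floor.comp (by fun_prop)
  exact (measurable_of_countable (fun k : ℤ => (k : ZMod M))).comp h

theorem unif_cell_eq_ge {M : ℕ} [NeZero M] (j : ZMod M) :
    ENNReal.ofReal (1 / M) ≤ unif {y | cell M y = j} := by
  have hM : (0 : ℝ) < M := by exact_mod_cast Nat.pos_of_ne_zero (NeZero.ne M)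
  have hsub : Set.Ico ((j.val : ℝ) / M) ((j.val + 1) / M) ⊆
      {y | cell M y = j} ∩ Set.Icc (0 : ℝ) 1 := by
    rintro y ⟨h1, h2⟩
    rw [div_le_iff₀ hM] at h1
    rw [lt_div_iff₀ hM] at h2
    have hj : (j.val : ℝ) + 1 ≤ M := by exact_mod_cast ZMod.val_lt j
    refine ⟨?_, ?_, ?_⟩
    · have : ⌊(M : ℝ) * y⌋ = (j.val : ℤ) := by
        rw [Int.floor_eq_iff]
        push_cast
        constructor <;> linarith
      simp [cell, this]
    · by_contra hcon
      push Not at hcon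
      have : (0 : ℝ) ≤ j.val := by positivity
      nlinarith
    · by_contra hcon
      push Not at hcon
      nlinarith
  have h : unif {y | cell M y = j} = volume ({y | cell M y = j} ∩ Set.Icc (0 : ℝ) 1) :=
    Measure.restrict_apply (measurable_cell M (measurableSet_singleton j))
  rw [h]
  refine le_trans (le_of_eq ?_) (measure_mono hsub)
  rw [Real.volume_Ico]
  congr 1
  ring

theorem unif_cell_notMem_le {M : ℕ} [NeZero M] (C : Finset (ZMod M)) :
    unif {y | cell M y ∉ C} ≤ ENNReal.ofReal (1 - C.card / M) := by
  have hmeas : MeasurableSet {y | cell M y ∈ C} := measurable_cell M C.measurableSet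
  have h1 : ENNReal.ofReal (C.card / M) ≤ unif {y | cell M y ∈ C} := by
    have : {y | cell M y ∈ C} = ⋃ j ∈ C, {y | cell M y = j} := by
      ext y; simp
    rw [this, measure_biUnion_finset]
    · calc ENNReal.ofReal (C.card / M) = ∑ j ∈ C, ENNReal.ofReal (1 / M) := by
            rw [Finset.sum_const, nsmul_eq_mul, div_eq_mul_one_div,
              ENNReal.ofReal_mul (by positivity), ENNReal.ofReal_natCast]
        _ ≤ _ := Finset.sum_le_sum fun j _ => unif_cell_eq_ge j
    · intro i _ j _ hij
      exact Set.disjoint_left.2 fun y h h' => hij (h.symm.trans h')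
    · exact fun j _ => measurable_cell M (measurableSet_singleton j)
  have h2 : {y | cell M y ∉ C} = {y | cell M y ∈ C}ᶜ := rfl
  rw [h2, prob_compl_eq_one_sub hmeas, ENNReal.ofReal_sub _ (by positivity), ENNReal.ofReal_one]
  gcongr

theorem locationLaw_cell_notMem_le (n : ℕ) {M : ℕ} [NeZero M] (C : Finset (ZMod M)) {N : ℝ}
    (hN : N ≤ C.card) :
    locationLaw n {x | ∀ u, cell M (x u) ∉ C} ≤ ENNReal.ofReal (Real.exp (-(n * N / M))) := by
  have h : {x : Fin n → ℝ | ∀ u, cell M (x u) ∉ C} = Set.univ.pi fun _ => {y | cell M y ∉ C} := by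
    ext x; simp
  rw [h, locationLaw, Measure.pi_pi, Finset.prod_const, Finset.card_univ, Fintype.card_fin]
  have h1 : unif {y | cell M y ∉ C} ≤ ENNReal.ofReal (Real.exp (-(N / M))) := by
    refine (unif_cell_notMem_le C).trans (ENNReal.ofReal_le_ofReal ?_)
    have h2 := Real.add_one_le_exp (-(N / M))
    have h3 : N / M ≤ C.card / M := by gcongr
    linarith
  calc _ ≤ ENNReal.ofReal (Real.exp (-(N / M))) ^ n := by gcongr
    _ = _ := by
      rw [← ENNReal.ofReal_pow (Real.exp_pos _).le, ← Real.exp_nat_mul]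
      congr 2
      ring

/-- The probability that some collection of at least `N` cells in a window of `K` cells contains no
location. -/
theorem locationLaw_exists_empty_cells_le (n : ℕ) {M K : ℕ} (hM : 0 < M) (hKM : K ≤ M) (N : ℝ) :
    locationLaw n {x | ¬ ∀ s : ℤ, ∀ T ⊆ Finset.Ico (0 : ℤ) K, N ≤ T.card →
      ∃ u, ∃ t ∈ T, cell M (x u) = ((s + t : ℤ) : ZMod M)} ≤
    ENNReal.ofReal (M * 2 ^ K * Real.exp (-(n * N / M))) := by
  have : NeZero M := ⟨hM.ne'⟩
  -- Union bound over the base cell of the window and the shape inside it: at most `M * 2 ^ K`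
  -- pairs.
  set I := (Finset.univ : Finset (ZMod M)) ×ˢ
    (Finset.Ico (0 : ℤ) K).powerset.filter (fun T => N ≤ T.card) with hI
  set D : ZMod M × Finset ℤ → Finset (ZMod M) := fun p => p.2.image fun t : ℤ => p.1 + (t : ZMod M)
    with hD
  have hsub : {x : Fin n → ℝ | ¬ ∀ s : ℤ, ∀ T ⊆ Finset.Ico (0 : ℤ) K, N ≤ T.card →
      ∃ u, ∃ t ∈ T, cell M (x u) = ((s + t : ℤ) : ZMod M)} ⊆
      ⋃ p ∈ I, {x | ∀ u, cell M (x u) ∉ D p} := by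
    intro x hx
    simp only [Set.mem_ofPred_eq] at hx
    push Not at hx
    obtain ⟨s, T, hT, hN, hno⟩ := hx
    refine Set.mem_biUnion (x := ((s : ZMod M), T)) ?_ ?_
    · simpa [hI, hN] using hT
    · intro u hu
      obtain ⟨t, ht, he⟩ := Finset.mem_image.1 hu
      refine hno u t ht ?_
      push_cast
      exact he.symm
  have hcard : ∀ p ∈ I, N ≤ (D p).card := by
    rintro ⟨s, T⟩ hp
    simp only [hI, Finset.mem_product, Finset.mem_filter, Finset.mem_powerset] at hp
    rw [hD, Finset.card_image_of_injOn]
    · exact hp.2.2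
    -- Since `K ≤ M`, distinct offsets in the window stay distinct modulo `M`.
    · intro t ht t' ht' h
      have h1 := Finset.mem_Ico.1 (hp.2.1 ht)
      have h2 := Finset.mem_Ico.1 (hp.2.1 ht')
      have h3 : (t : ZMod M) = t' := add_left_cancel h
      rw [ZMod.intCast_eq_intCast_iff, Int.ModEq, Int.emod_eq_of_lt h1.1 (by omega),
        Int.emod_eq_of_lt h2.1 (by omega)] at h3
      exact h3
  calc _ ≤ locationLaw n (⋃ p ∈ I, {x | ∀ u, cell M (x u) ∉ D p}) := measure_mono hsub
    _ ≤ ∑ p ∈ I, locationLaw n {x | ∀ u, cell M (x u) ∉ D p} := measure_biUnion_finset_le _ _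
    _ ≤ ∑ p ∈ I, ENNReal.ofReal (Real.exp (-(n * N / M))) :=
        Finset.sum_le_sum fun p hp => locationLaw_cell_notMem_le n _ (hcard p hp)
    _ = ENNReal.ofReal (I.card * Real.exp (-(n * N / M))) := by
        rw [Finset.sum_const, nsmul_eq_mul, ENNReal.ofReal_mul (by positivity),
          ENNReal.ofReal_natCast]
    _ ≤ _ := by
        refine ENNReal.ofReal_le_ofReal (mul_le_mul_of_nonneg_right ?_ (Real.exp_pos _).le)
        have : I.card ≤ M * 2 ^ K := by
          rw [hI, Finset.card_product, Finset.card_univ, ZMod.card]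
          refine Nat.mul_le_mul_left _ ((Finset.card_filter_le _ _).trans ?_)
          simp
        exact_mod_cast this

/-! ### Propagation succeeds on a connected vertex-random graph -/

theorem measurable_gbm {n : ℕ} (rs rd : ℝ) (V₁ : Finset (Fin n)) :
    Measurable fun x : Fin n → ℝ => gbm rs rd V₁ x := by
  rw [SimpleGraph.measurable_iff_adj]
  intro u v
  refine Measurable.and measurable_const (Measurable.or (Measurable.and measurable_const ?_)
    (Measurable.and measurable_const ?_)) <;>
  exact measurableSet_setOfPred.1 (measurableSet_le (measurable_circDist u v) measurable_const)

theorem measurable_algorithm_apply {n : ℕ} (rs rd : ℝ) (A : Algorithm n) (V₁ : Finset (Fin n))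
    (S : Set (Finset (Fin n))) :
    Measurable fun x : Fin n → ℝ => A (gbm rs rd V₁ x, x) S :=
  (A.measurable_coe S.toFinite.measurableSet).comp
    ((measurable_gbm rs rd V₁).prodMk measurable_id)

theorem gbm_adj_iff_of_vrg_adj {n : ℕ} {rs rd : ℝ} {V₁ : Finset (Fin n)} {x : Fin n → ℝ}
    {u v : Fin n} (h : (vrg rd rs x).Adj u v) (hne : circDist (x u) (x v) ≠ rd) :
    (gbm rs rd V₁ x).Adj u v ↔ (u ∈ V₁ ↔ v ∈ V₁) := by
  obtain ⟨h1, h2, h3⟩ := h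
  have h4 : ¬ circDist (x u) (x v) ≤ rd := fun h => hne (le_antisymm h h2)
  simp only [gbm]
  tauto

/-- Every label that can be received records whether the vertex lies in the part of the root, so no
conflict arises, and connectedness gives each vertex a label. Ties at distance `rd` must be excluded
because such pairs are adjacent whatever their parts. -/
theorem propagatedPart_mem_correct {n : ℕ} (hn : 0 < n) {rs rd : ℝ} (V₁ : Finset (Fin n))
    (x : Fin n → ℝ) (hconn : ∀ u v, (vrg rd rs x).Reachable u v)
    (hne : ∀ u v, u ≠ v → circDist (x u) (x v) ≠ rd) :
    propagatedPart (gbm rs rd V₁ x) (vrg rd rs x) ∈ correct V₁ := by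
  set r : Fin n := ⟨0, hn⟩
  have sound : ∀ v c, Propagated (gbm rs rd V₁ x) (vrg rd rs x) v c →
      (c = true ↔ (v ∈ V₁ ↔ r ∈ V₁)) := by
    intro v c h
    induction h with
    | root u hu =>
      have : u = r := Fin.ext hu
      simp [this]
    | same u v c _ hH hG ih =>
      rw [gbm_adj_iff_of_vrg_adj hH (hne u v hH.1)] at hG
      rw [ih, hG]
    | diff u v c _ hH hG ih =>
      rw [gbm_adj_iff_of_vrg_adj hH (hne u v hH.1)] at hG
      have : (!c) = true ↔ ¬ (c = true) := by simp
      rw [this, ih]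
      tauto
  have total : ∀ v, ∃ c, Propagated (gbm rs rd V₁ x) (vrg rd rs x) v c := by
    intro v
    have h := (SimpleGraph.reachable_iff_reflTransGen _ _).1 (hconn r v)
    induction h with
    | refl => exact ⟨true, .root r rfl⟩
    | tail _ hH ih =>
      obtain ⟨c, hc⟩ := ih
      rename_i y z _
      by_cases hG : (gbm rs rd V₁ x).Adj y z
      · exact ⟨c, .same _ _ _ hc hH hG⟩
      · exact ⟨!c, .diff _ _ _ hc hH hG⟩
  have key : ∀ v, Propagated (gbm rs rd V₁ x) (vrg rd rs x) v true ↔ (v ∈ V₁ ↔ r ∈ V₁) := by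
    intro v
    obtain ⟨c, hc⟩ := total v
    refine ⟨fun h => (sound v _ h).1 rfl, fun h => ?_⟩
    rwa [← (sound v c hc).2 h]
  by_cases hr : r ∈ V₁
  · left
    ext v
    simp [propagatedPart, key, hr]
  · right
    ext v
    simp [propagatedPart, key, hr]

/-- A measurable set of configurations is null if all its sections along one coordinate are. -/
theorem locationLaw_eq_zero_of_section {n : ℕ} {S : Set (Fin n → ℝ)} (hS : MeasurableSet S)
    (v : Fin n) (h : ∀ x, unif {z | Function.update x v z ∈ S} = 0) : locationLaw n S = 0 := by
  rw [← lintegral_indicator_one hS, ← nonpos_iff_eq_zero]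
  refine (lintegral_le_of_lmarginal_le (μ := fun _ : Fin n => unif) {v} (g := fun _ => 0)
    (measurable_one.indicator hS) measurable_const fun x => ?_).trans (by simp)
  rw [lmarginal_singleton]
  have h1 : (fun z => S.indicator (1 : (Fin n → ℝ) → ENNReal) (Function.update x v z)) =
      {z | Function.update x v z ∈ S}.indicator 1 := rfl
  have h2 : MeasurableSet {z | Function.update x v z ∈ S} := measurable_update x hS
  simp only
  rw [h1, lintegral_indicator_one h2, h x]
  exact zero_le

theorem ae_circDist_ne {n : ℕ} (r : ℝ) :
    ∀ᵐ x ∂(locationLaw n), ∀ u v : Fin n, u ≠ v → circDist (x u) (x v) ≠ r := by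
  rw [ae_all_iff]
  intro u
  rw [ae_all_iff]
  intro v
  by_cases huv : u = v
  · simp [huv]
  have hS : MeasurableSet {x : Fin n → ℝ | circDist (x u) (x v) = r} :=
    measurableSet_eq_fun (measurable_circDist u v) measurable_const
  have h0 := locationLaw_eq_zero_of_section hS v fun x => ?_
  · filter_upwards [measure_eq_zero_iff_ae_notMem.1 h0] with x hx _ using hx
  -- With the location of `u` fixed, at most four locations of `v` give the distance `r`.
  · have hfin : ({x u + r, x u - r, x u + (1 - r), x u - (1 - r)} : Set ℝ).Finite := by simp
    refine measure_mono_null ?_ (hfin.measure_zero _)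
    intro z hz
    simp only [Set.mem_ofPred_eq, Function.update_self, Function.update_of_ne huv, circDist] at hz
    simp only [Set.mem_insert_iff, Set.mem_singleton_iff]
    rcases min_choice |x u - z| (1 - |x u - z|) with h | h <;> rw [h] at hz <;>
      rcases abs_choice (x u - z) with h' | h' <;> rw [h'] at hz
    · right; left; linarith
    · left; linarith
    · right; right; right; linarith
    · right; right; left; linarith

theorem successProb_le_one {n : ℕ} (rs rd : ℝ) (A : Algorithm n) [IsMarkovKernel A]
    (V₁ : Finset (Fin n)) : successProb rs rd A V₁ ≤ 1 := by
  unfold successProb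
  calc _ ≤ ∫⁻ _, 1 ∂(locationLaw n) := lintegral_mono fun x => prob_le_one
    _ = 1 := by simp

/-- The propagation procedure fails at most with the probability that the vertex-random graph is
not connected. -/
theorem one_sub_le_successProb_propagation {n : ℕ} (hn : 0 < n) (rs rd : ℝ)
    (V₁ : Finset (Fin n)) :
    1 - locationLaw n {x | ¬ ∀ u v, (vrg rd rs x).Reachable u v} ≤
      successProb rs rd (propagation rs rd) V₁ := by
  set f := fun x : Fin n → ℝ => propagation rs rd (gbm rs rd V₁ x, x) (correct V₁) with hf
  have hfm : Measurable f := measurable_algorithm_apply rs rd _ V₁ _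
  have h1 : locationLaw n {x | 1 ≤ f x} ≤ successProb rs rd (propagation rs rd) V₁ := by
    have := mul_meas_ge_le_lintegral (μ := locationLaw n) hfm 1
    rwa [one_mul] at this
  refine le_trans (tsub_le_iff_left.2 ?_) h1
  calc (1 : ENNReal) = locationLaw n Set.univ := measure_univ.symm
    _ ≤ locationLaw n ({x | ¬ ∀ u v, (vrg rd rs x).Reachable u v} ∪ {x | 1 ≤ f x}) := by
      refine measure_mono_ae ?_
      filter_upwards [ae_circDist_ne rd] with x hx _
      by_cases hc : ∀ u v, (vrg rd rs x).Reachable u v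
      · right
        have := propagatedPart_mem_correct hn V₁ x hc hx
        simp only [Set.mem_ofPred_eq, hf, propagation]
        rw [Kernel.deterministic_apply' _ _ (Set.toFinite _).measurableSet]
        simp [this]
      · left; exact hc
    _ ≤ _ := measure_union_le _ _

/-! ### Connectedness with high probability -/

theorem locationLaw_vrg_not_connected_le {n : ℕ} {r₁ r₂ τ : ℝ} (h₁ : 0 ≤ r₁) (h₂ : r₂ < 1 / 2)
    (hτ : 0 ≤ τ) (hτ₂ : τ < r₂) (hτ₁ : τ < 2 * (r₂ - r₁)) {M K : ℕ} {N : ℝ} (hM : 0 < M)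
    (hKM : K ≤ M) (hK : 2 * r₂ * M ≤ K) (hN : N ≤ M * τ - 8) :
    locationLaw n {x | ¬ ∀ u v, (vrg r₁ r₂ x).Reachable u v} ≤
      ENNReal.ofReal (M * 2 ^ K * Real.exp (-(n * N / M))) := by
  refine le_trans (measure_mono_ae ?_) (locationLaw_exists_empty_cells_le n hM hKM N)
  filter_upwards [ae_mem_Icc n] with x hx hno hcell
  exact hno (vrg_reachable_of_cells x hx h₁ h₂ hτ hτ₂ hτ₁ hM hK hN hcell)

theorem tendsto_log_div_nat : Tendsto (fun n : ℕ => Real.log n / n) atTop (𝓝 0) := by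
  have h := (Real.isLittleO_log_id_atTop).tendsto_div_nhds_zero
  exact h.comp tendsto_natCast_atTop_atTop

theorem tendsto_log_nat : Tendsto (fun n : ℕ => Real.log n) atTop atTop :=
  Real.tendsto_log_atTop.comp tendsto_natCast_atTop_atTop

theorem tendsto_vrg_not_connected {a b : ℝ} (hb : 0 ≤ b) (hab : 1 / 2 < a - b) (ha : 1 < a) :
    Tendsto (fun n : ℕ => locationLaw n
      {x | ¬ ∀ u v, (vrg (radius b n) (radius a n) x).Reachable u v}) atTop (𝓝 0) := by
  obtain ⟨δ, hδ, hδa, hδb⟩ : ∃ δ : ℝ, 0 < δ ∧ 1 + δ < a ∧ 1 + δ < 2 * (a - b) := by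
    have : 1 < min a (2 * (a - b)) := lt_min ha (by linarith)
    obtain ⟨c, hc, hc'⟩ := exists_between this
    obtain ⟨h1, h2⟩ := lt_min_iff.1 hc'
    exact ⟨c - 1, by linarith, by linarith, by linarith⟩
  -- With `M` about `E * n / log n` cells and `τ = (1 + δ) * log n / n`, the rounding loss of `8`
  -- cells equals `δ / 2 * E`. The cells left have measure at least `(1 + δ / 2) * log n / n`, while
  -- the window has a bounded number `K` of cells.
  set E := 16 / δ with hE
  have hE0 : 0 < E := by positivity
  set K := ⌈2 * a * (E + 1)⌉₊ with hK
  have hlim : Tendsto (fun n : ℕ =>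
      ENNReal.ofReal ((E + 1) * 2 ^ K * Real.exp (-(δ / 2 * Real.log n)))) atTop (𝓝 0) := by
    rw [← ENNReal.ofReal_zero]
    refine ENNReal.tendsto_ofReal ?_
    rw [← mul_zero ((E + 1) * 2 ^ K)]
    refine Tendsto.const_mul _ (Real.tendsto_exp_neg_atTop_nhds_zero.comp ?_)
    exact tendsto_log_nat.const_mul_atTop (by positivity)
  refine tendsto_of_tendsto_of_tendsto_of_le_of_le' tendsto_const_nhds hlim
    (Eventually.of_forall fun _ => zero_le) ?_
  have hs1 : ∀ᶠ n : ℕ in atTop, Real.log n / n < 1 / (2 * a) :=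
    tendsto_log_div_nat.eventually_lt_const (by positivity)
  have hs2 : ∀ᶠ n : ℕ in atTop, Real.log n / n < 1 :=
    tendsto_log_div_nat.eventually_lt_const (by positivity)
  have hs3 : ∀ᶠ n : ℕ in atTop, Real.log n / n < E / (K + 1) :=
    tendsto_log_div_nat.eventually_lt_const (by positivity)
  filter_upwards [hs1, hs2, hs3, tendsto_log_nat.eventually_ge_atTop 1, eventually_gt_atTop 0]
    with n hn1 hn2 hn3 hlog hn0
  have hn : (0 : ℝ) < n := by exact_mod_cast hn0
  set ℓ := Real.log n / n with hℓ
  have hℓ0 : 0 < ℓ := by positivity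
  have hnℓ : n * ℓ = Real.log n := by rw [hℓ]; field_simp
  have hr : ∀ c, radius c n = c * ℓ := fun c => by rw [radius, hℓ, mul_div_assoc]
  set M := ⌈E / ℓ⌉₊ with hM
  have hM1 : E / ℓ ≤ M := Nat.le_ceil _
  have hM2 : (M : ℝ) < E / ℓ + 1 := Nat.ceil_lt_add_one (by positivity)
  have hM1' : E ≤ M * ℓ := by rwa [div_le_iff₀ hℓ0] at hM1
  have hM2' : M * ℓ ≤ E + 1 := by
    have := mul_lt_mul_of_pos_right hM2 hℓ0
    rw [add_mul, div_mul_cancel₀ _ hℓ0.ne'] at this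
    linarith
  have hM0 : 0 < M := Nat.ceil_pos.2 (by positivity)
  have hM0' : (0 : ℝ) < M := by exact_mod_cast hM0
  rw [hr, hr]
  refine (locationLaw_vrg_not_connected_le (τ := (1 + δ) * ℓ) (M := M) (K := K)
    (N := M * ((1 + δ / 2) * ℓ)) (by positivity) ?_ (by positivity) (by gcongr) ?_ hM0 ?_ ?_
    ?_).trans ?_
  · rw [lt_div_iff₀ (by positivity)] at hn1
    linarith
  · have := mul_lt_mul_of_pos_right hδb hℓ0
    linarith
  · rw [lt_div_iff₀ (by positivity)] at hn3
    have : (K : ℝ) ≤ M := by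
      refine le_of_mul_le_mul_right ?_ hℓ0
      linarith
    exact_mod_cast this
  · refine le_trans ?_ (Nat.le_ceil _)
    have := mul_le_mul_of_nonneg_left hM2' (by linarith : 0 ≤ 2 * a)
    linarith
  · have h8 : δ / 2 * E = 8 := by rw [hE]; field_simp; norm_num
    have := mul_le_mul_of_nonneg_left hM1' (by linarith : 0 ≤ δ / 2)
    linarith
  · refine ENNReal.ofReal_le_ofReal ?_
    have e1 : -((n : ℝ) * (M * ((1 + δ / 2) * ℓ)) / M) =
        -Real.log n + -(δ / 2 * Real.log n) := by
      rw [← hnℓ]; field_simp; ring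
    rw [e1, Real.exp_add, Real.exp_neg, Real.exp_log hn]
    have e2 : (M : ℝ) ≤ (E + 1) * n := by
      have : (M : ℝ) * (n * ℓ) ≤ (E + 1) * n := by nlinarith
      rw [hnℓ] at this
      nlinarith
    have e3 : (M : ℝ) * (n : ℝ)⁻¹ ≤ E + 1 := by
      rwa [← div_eq_mul_inv, div_le_iff₀ hn]
    calc (M : ℝ) * 2 ^ K * ((n : ℝ)⁻¹ * Real.exp (-(δ / 2 * Real.log n)))
        = (M * (n : ℝ)⁻¹) * (2 ^ K * Real.exp (-(δ / 2 * Real.log n))) := by ring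
      _ ≤ (E + 1) * (2 ^ K * Real.exp (-(δ / 2 * Real.log n))) := by gcongr
      _ = _ := by ring

theorem tendsto_two_mul : Tendsto (fun m : ℕ => 2 * m) atTop atTop :=
  tendsto_id.const_mul_atTop' (by norm_num)

theorem tendsto_successProb_propagation {a b : ℝ} (hb : 0 ≤ b) (hab : 1 / 2 < a - b) (ha : 1 < a)
    (V₁ : (m : ℕ) → Finset (Fin (2 * m))) :
    Tendsto (fun m : ℕ => successProb (radius a (2 * m)) (radius b (2 * m))
      (propagation (radius a (2 * m)) (radius b (2 * m))) (V₁ m)) atTop (𝓝 1) := by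
  have h := (tendsto_vrg_not_connected hb hab ha).comp tendsto_two_mul
  have h' := ENNReal.Tendsto.sub (tendsto_const_nhds (x := (1 : ENNReal))) h (Or.inl (by simp))
  rw [tsub_zero] at h'
  refine tendsto_of_tendsto_of_tendsto_of_le_of_le' h' tendsto_const_nhds ?_
    (Eventually.of_forall fun m => successProb_le_one _ _ _ _)
  filter_upwards [eventually_gt_atTop 0] with m hm
  exact one_sub_le_successProb_propagation (Nat.mul_pos two_pos hm) _ _ _

/-! ### Counting the label sets compatible with a graph -/

theorem gbm_eq_of_iff_of_vrg_adj {n : ℕ} {rs rd : ℝ} (hr : rd ≤ rs) {V W : Finset (Fin n)}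
    {x : Fin n → ℝ} (h : ∀ u v, (vrg rd rs x).Adj u v → ((u ∈ V ↔ v ∈ V) ↔ (u ∈ W ↔ v ∈ W))) :
    gbm rs rd V x = gbm rs rd W x := by
  ext u v
  have h' := h u v
  simp only [gbm, vrg] at h' ⊢
  by_cases huv : u = v
  · simp [huv]
  rcases lt_or_ge (circDist (x u) (x v)) rd with h1 | h1
  · simp only [h1.le.trans hr, h1.le, and_true, em]
  · by_cases h2 : circDist (x u) (x v) ≤ rs
    · rw [h' ⟨huv, h1, h2⟩]
    · have h3 : ¬ circDist (x u) (x v) ≤ rd := fun h => h2 (h.trans hr)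
      simp [h2, h3]

theorem gbm_compl {n : ℕ} (rs rd : ℝ) (V : Finset (Fin n)) (x : Fin n → ℝ) :
    gbm rs rd Vᶜ x = gbm rs rd V x := by
  ext u v
  simp only [gbm, Finset.mem_compl]
  tauto

/-- A set of vertices in pairwise different components of the vertex-random graph. -/
def Separated {n : ℕ} (rs rd : ℝ) (x : Fin n → ℝ) (I : Finset (Fin n)) : Prop :=
  ∀ u ∈ I, ∀ v ∈ I, (vrg rd rs x).Reachable u v → u = v

open Classical in
-- Each subset of `I` selects a union of components to flip. The flips preserve the graph and are
-- told apart by their traces on `I`, so every fibre of the map from label sets to graphs has at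
-- least `2 ^ I.card` elements. Balance is not preserved, hence the count over all subsets.
theorem two_pow_mul_card_image_gbm_le {n : ℕ} {rs rd : ℝ} (hr : rd ≤ rs) (x : Fin n → ℝ)
    {I : Finset (Fin n)} (hI : Separated rs rd x I) :
    2 ^ I.card * (Finset.univ.image fun V : Finset (Fin n) => gbm rs rd V x).card ≤ 2 ^ n := by
  have key := Finset.mul_card_image_le_card (s := (Finset.univ : Finset (Finset (Fin n))))
    (f := fun V => gbm rs rd V x) (2 ^ I.card) ?_
  · simpa using key
  · rintro G hG
    obtain ⟨V, -, rfl⟩ := Finset.mem_image.1 hG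
    rw [← Finset.card_powerset]
    set F : Finset (Fin n) → Finset (Fin n) := fun T =>
      symmDiff V (Finset.univ.filter fun v => ∃ u ∈ T, (vrg rd rs x).Reachable u v) with hF
    refine Finset.card_le_card_of_injOn F ?_ ?_
    · intro T _
      simp only [Finset.coe_filter, Finset.mem_univ, true_and, Set.mem_ofPred_eq]
      refine gbm_eq_of_iff_of_vrg_adj hr fun u v huv => ?_
      have h : (∃ w ∈ T, (vrg rd rs x).Reachable w u) ↔ ∃ w ∈ T, (vrg rd rs x).Reachable w v :=
        ⟨fun ⟨w, h, h'⟩ => ⟨w, h, h'.trans huv.reachable⟩,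
          fun ⟨w, h, h'⟩ => ⟨w, h, h'.trans huv.symm.reachable⟩⟩
      simp only [hF, Finset.mem_symmDiff, Finset.mem_filter, Finset.mem_univ, true_and]
      rw [h]
      generalize (∃ w ∈ T, (vrg rd rs x).Reachable w v) = q
      tauto
    · intro T hT T' hT' h
      have h' := symmDiff_right_injective V h
      have hrec : ∀ {S : Finset (Fin n)}, S ⊆ I → ∀ v ∈ I,
          (v ∈ Finset.univ.filter fun v => ∃ u ∈ S, (vrg rd rs x).Reachable u v) ↔ v ∈ S := by
        intro S hS v hv
        simp only [Finset.mem_filter, Finset.mem_univ, true_and]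
        exact ⟨fun ⟨u, hu, huv⟩ => hI u (hS hu) v hv huv ▸ hu,
          fun h => ⟨v, h, SimpleGraph.Reachable.refl _⟩⟩
      have hTI : T ⊆ I := by simpa using hT
      have hTI' : T' ⊆ I := by simpa using hT'
      ext v
      by_cases hv : v ∈ I
      · rw [← hrec hTI v hv, ← hrec hTI' v hv]
        rw [h']
      · exact ⟨fun h => absurd (hTI h) hv, fun h => absurd (hTI' h) hv⟩

open Classical in
theorem sum_algorithm_singleton_le {n : ℕ} (rs rd : ℝ) (A : Algorithm n) [IsMarkovKernel A]
    (x : Fin n → ℝ) :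
    ∑ V : Finset (Fin n), A (gbm rs rd V x, x) {V} ≤
      ((Finset.univ.image fun V : Finset (Fin n) => gbm rs rd V x).card : ENNReal) := by
  rw [← Finset.sum_fiberwise_of_maps_to (s := Finset.univ)
    (t := Finset.univ.image fun V : Finset (Fin n) => gbm rs rd V x)
    (g := fun V => gbm rs rd V x) (fun V hV => Finset.mem_image_of_mem _ hV)]
  rw [Finset.cast_card]
  refine Finset.sum_le_sum fun G _ => ?_
  calc _ = ∑ V with gbm rs rd V x = G, A (G, x) {V} :=
        Finset.sum_congr rfl fun V hV => by rw [(Finset.mem_filter.1 hV).2]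
    _ = A (G, x) (Finset.univ.filter fun V => gbm rs rd V x = G : Finset (Finset (Fin n))) :=
        sum_measure_singleton
    _ ≤ 1 := prob_le_one

/-- For each observed graph the output law has total mass one to share among the label sets in its
fibre. The factor `2` pays for the unnamed parts. -/
theorem sum_algorithm_correct_mul_le {n : ℕ} {rs rd : ℝ} (hr : rd ≤ rs) (A : Algorithm n)
    [IsMarkovKernel A] (x : Fin n → ℝ) {I : Finset (Fin n)} (hI : Separated rs rd x I)
    (P : Finset (Finset (Fin n))) :
    (∑ V ∈ P, A (gbm rs rd V x, x) (correct V)) * 2 ^ I.card ≤ 2 * 2 ^ n := by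
  classical
  have h1 := sum_algorithm_singleton_le rs rd A x
  have h2 : ∑ V : Finset (Fin n), A (gbm rs rd V x, x) {Vᶜ} =
      ∑ V : Finset (Fin n), A (gbm rs rd V x, x) {V} :=
    Fintype.sum_bijective compl compl_bijective _ _ fun V => by rw [gbm_compl]
  have h3 : ∑ V ∈ P, A (gbm rs rd V x, x) (correct V) ≤
      2 * ((Finset.univ.image fun V : Finset (Fin n) => gbm rs rd V x).card : ENNReal) := by
    calc _ ≤ ∑ V : Finset (Fin n), A (gbm rs rd V x, x) (correct V) :=
          Finset.sum_le_sum_of_subset (Finset.subset_univ P)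
      _ ≤ ∑ V : Finset (Fin n), (A (gbm rs rd V x, x) {V} + A (gbm rs rd V x, x) {Vᶜ}) :=
          Finset.sum_le_sum fun V _ => measure_union_le {V} {Vᶜ}
      _ ≤ _ := by
          rw [Finset.sum_add_distrib, h2, two_mul]
          gcongr
  have h4 := two_pow_mul_card_image_gbm_le hr x hI
  calc _ ≤ 2 * ((Finset.univ.image fun V : Finset (Fin n) => gbm rs rd V x).card : ENNReal) *
        2 ^ I.card := by gcongr
    _ = 2 * ((2 ^ I.card *
        (Finset.univ.image fun V : Finset (Fin n) => gbm rs rd V x).card : ℕ) : ENNReal) := by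
        push_cast; ring
    _ ≤ 2 * ((2 ^ n : ℕ) : ENNReal) := by gcongr
    _ = _ := by push_cast; rfl

theorem successProb_add_errorProb {n : ℕ} (rs rd : ℝ) (A : Algorithm n) [IsMarkovKernel A]
    (V₁ : Finset (Fin n)) : successProb rs rd A V₁ + errorProb rs rd A V₁ = 1 := by
  unfold successProb errorProb
  rw [← lintegral_add_left (measurable_algorithm_apply rs rd A V₁ _)]
  have h : ∀ x : Fin n → ℝ, A (gbm rs rd V₁ x, x) (correct V₁) +
      A (gbm rs rd V₁ x, x) (correct V₁)ᶜ = 1 := fun x => by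
    rw [measure_add_measure_compl (Set.toFinite _).measurableSet, measure_univ]
  simp [h]

theorem averageErrorProb_le_one {m : ℕ} (rs rd : ℝ) (A : Algorithm (2 * m)) [IsMarkovKernel A] :
    averageErrorProb rs rd A ≤ 1 := by
  unfold averageErrorProb
  refine ENNReal.div_le_of_le_mul ?_
  rw [one_mul, Finset.cast_card]
  exact Finset.sum_le_sum fun V _ => by
    rw [← successProb_add_errorProb rs rd A V]; exact le_add_self

theorem sum_successProb_le {n : ℕ} {rs rd : ℝ} (hr : rd ≤ rs) (A : Algorithm n)
    [IsMarkovKernel A] (K : ℕ) (P : Finset (Finset (Fin n))) :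
    ∑ V ∈ P, successProb rs rd A V ≤ 2 * 2 ^ n / 2 ^ K +
      P.card * locationLaw n {x | ¬ ∃ I, K ≤ I.card ∧ Separated rs rd x I} := by
  set S := {x : Fin n → ℝ | ¬ ∃ I, K ≤ I.card ∧ Separated rs rd x I} with hS
  -- A measurable hull avoids proving that the existence of a separated set is a measurable event.
  set S' := toMeasurable (locationLaw n) S
  unfold successProb
  rw [← lintegral_finsetSum _ fun V _ => measurable_algorithm_apply rs rd A V _]
  calc _ ≤ ∫⁻ x, (2 * 2 ^ n / 2 ^ K + P.card * S'.indicator 1 x) ∂(locationLaw n) := by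
        refine lintegral_mono fun x => ?_
        by_cases hx : x ∈ S
        · have hx' : x ∈ S' := subset_toMeasurable _ _ hx
          refine le_trans ?_ le_add_self
          rw [Set.indicator_of_mem hx', Pi.one_apply, mul_one, Finset.cast_card]
          exact Finset.sum_le_sum fun V _ => prob_le_one
        · refine le_trans ?_ le_self_add
          simp only [hS, Set.mem_ofPred_eq, not_not] at hx
          obtain ⟨I, hK, hI⟩ := hx
          rw [ENNReal.le_div_iff_mul_le (Or.inl (by positivity)) (Or.inl (by simp))]
          refine le_trans ?_ (sum_algorithm_correct_mul_le hr A x hI P)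
          gcongr
          exact one_le_two
    _ = _ := by
        rw [lintegral_add_left measurable_const, lintegral_const_mul _
          (measurable_one.indicator (measurableSet_toMeasurable _ _)),
          lintegral_indicator_one (measurableSet_toMeasurable _ _), measure_toMeasurable]
        simp

/-- Restricting the count to balanced sets costs only a factor `2 * m`, because `4 ^ m ≤ 2 * m *
m.centralBinom`. -/
theorem one_sub_le_averageErrorProb {m : ℕ} (hm : 0 < m) {rs rd : ℝ} (hr : rd ≤ rs)
    (A : Algorithm (2 * m)) [IsMarkovKernel A] (K : ℕ) :
    1 - (ENNReal.ofReal (2 * (2 * m : ℕ) / 2 ^ K) +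
      locationLaw (2 * m) {x | ¬ ∃ I, K ≤ I.card ∧ Separated rs rd x I}) ≤
      averageErrorProb rs rd A := by
  set P := Finset.powersetCard m (Finset.univ : Finset (Fin (2 * m))) with hP
  have hPc : P.card = m.centralBinom := by
    rw [hP, Finset.card_powersetCard, Finset.card_univ, Fintype.card_fin, Nat.centralBinom]
  have hP0 : 0 < P.card := hPc ▸ Nat.centralBinom_pos m
  have hP0' : (P.card : ENNReal) ≠ 0 := by exact_mod_cast hP0.ne'
  have hPt : (P.card : ENNReal) ≠ ⊤ := ENNReal.natCast_ne_top _
  have h1 : (∑ V ∈ P, successProb rs rd A V) / P.card + averageErrorProb rs rd A = 1 := by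
    unfold averageErrorProb
    rw [ENNReal.div_add_div_same, ← Finset.sum_add_distrib,
      Finset.sum_congr rfl fun V _ => successProb_add_errorProb rs rd A V, ← Finset.cast_card]
    exact ENNReal.div_self hP0' hPt
  rw [tsub_le_iff_left, ← h1]
  gcongr
  refine (ENNReal.div_le_div_right (sum_successProb_le hr A K P) _).trans ?_
  rw [ENNReal.add_div, mul_comm (P.card : ENNReal), ENNReal.mul_div_cancel_right hP0' hPt]
  gcongr
  refine ENNReal.div_le_of_le_mul ?_
  have h2 : (4 : ℝ) ^ m ≤ 2 * m * P.card := by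
    rw [hPc]; exact_mod_cast Nat.four_pow_le_two_mul_self_mul_centralBinom m hm
  have h3 : (2 : ENNReal) * 2 ^ (2 * m) / 2 ^ K = ENNReal.ofReal (2 * 2 ^ (2 * m) / 2 ^ K) := by
    rw [ENNReal.ofReal_div_of_pos (by positivity), ENNReal.ofReal_mul (by positivity),
      ENNReal.ofReal_pow (by positivity), ENNReal.ofReal_pow (by positivity)]
    simp
  rw [h3, ← ENNReal.ofReal_natCast P.card, ← ENNReal.ofReal_mul (by positivity)]
  refine ENNReal.ofReal_le_ofReal ?_
  rw [div_mul_eq_mul_div, pow_mul]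
  refine div_le_div_of_nonneg_right ?_ (by positivity)
  push_cast
  norm_num
  linarith

/-! ### Rotation invariance and moments of the number of lonely vertices -/

theorem unif_fract_sub {B : Set ℝ} (hB : MeasurableSet B) (y : ℝ) :
    unif {z | Int.fract (z - y) ∈ B} = unif B := by
  have hmeas : MeasurableSet {z : ℝ | Int.fract z ∈ B} := measurable_fract hB
  have hshift : MeasurableSet {z : ℝ | Int.fract (z - y) ∈ B} :=
    (measurable_fract.comp (measurable_id.sub_const y)) hB
  have h0 : ∀ S : Set ℝ, unif S = volume (S ∩ Set.Ioc 0 (0 + 1)) := by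
    intro S
    rw [zero_add, unif, Measure.restrict_congr_set Ioc_ae_eq_Icc.symm,
      Measure.restrict_apply' measurableSet_Ioc]
  have h1 : volume ({z : ℝ | Int.fract (z - y) ∈ B} ∩ Set.Ioc 0 (0 + 1)) =
      volume ({z : ℝ | Int.fract z ∈ B} ∩ Set.Ioc (-y) (-y + 1)) := by
    have h2 : {z : ℝ | Int.fract (z - y) ∈ B} ∩ Set.Ioc 0 (0 + 1) =
        (fun z => z + -y) ⁻¹' ({z : ℝ | Int.fract z ∈ B} ∩ Set.Ioc (-y) (-y + 1)) := by
      ext z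
      simp only [Set.mem_inter_iff, Set.mem_ofPred_eq, Set.mem_Ioc, Set.mem_preimage,
        ← sub_eq_add_neg]
      refine and_congr Iff.rfl (and_congr ?_ ?_) <;> constructor <;> intro h <;> linarith
    rw [h2, measure_preimage_add_right]
  have h3 : volume ({z : ℝ | Int.fract z ∈ B} ∩ Set.Ioc (-y) (-y + 1)) =
      volume ({z : ℝ | Int.fract z ∈ B} ∩ Set.Ioc 0 (0 + 1)) := by
    refine (isAddFundamentalDomain_Ioc one_pos (-y)).measure_set_eq
      (isAddFundamentalDomain_Ioc one_pos 0) hmeas ?_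
    rintro ⟨g, hg⟩
    obtain ⟨k, rfl⟩ := AddSubgroup.mem_zmultiples_iff.1 hg
    ext z
    simp [AddSubgroup.vadd_def]
  rw [h0, h1, h3, ← h0]
  have h4 : ∀ᵐ z ∂unif, z ≠ 1 := by
    refine ae_restrict_of_ae ?_
    simp [ae_iff]
  refine measure_congr ?_
  filter_upwards [h4, (ae_restrict_mem measurableSet_Icc : ∀ᵐ z ∂unif, z ∈ Set.Icc (0 : ℝ) 1)]
    with z hz hz'
  have : Int.fract z = z := Int.fract_eq_self.2 ⟨hz'.1, lt_of_le_of_ne hz'.2 hz⟩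
  change (Int.fract z ∈ B) = (z ∈ B)
  rw [this]

/-- The set of configurations for which no vertex other than `u` has a position relative to `u`
in `B`. -/
def lonely {n : ℕ} (B : Set ℝ) (u : Fin n) : Set (Fin n → ℝ) :=
  {x | ∀ v, v ≠ u → Int.fract (x v - x u) ∉ B}

theorem measurableSet_fract_sub {n : ℕ} {B : Set ℝ} (hB : MeasurableSet B) (u v : Fin n) :
    MeasurableSet {x : Fin n → ℝ | Int.fract (x v - x u) ∈ B} :=
  (measurable_fract.comp ((measurable_pi_apply v).sub (measurable_pi_apply u))) hB

theorem measurableSet_lonely {n : ℕ} {B : Set ℝ} (hB : MeasurableSet B) (u : Fin n) :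
    MeasurableSet (lonely B u) := by
  have : lonely B u = ⋂ v, ⋂ _ : v ≠ u, {x : Fin n → ℝ | Int.fract (x v - x u) ∈ B}ᶜ := by
    ext x; simp [lonely]
  rw [this]
  exact MeasurableSet.iInter fun v => MeasurableSet.iInter fun _ =>
    (measurableSet_fract_sub hB u v).compl

/-- Integrating out the coordinates in `s` of the indicator of a set whose sections are cubes. -/
theorem lmarginal_indicator_cube {n : ℕ} {S : Set (Fin n → ℝ)} (hS : MeasurableSet S)
    (s : Finset (Fin n)) (x : Fin n → ℝ) (Q : Set ℝ)
    (hSQ : ∀ y : s → ℝ, Function.updateFinset x s y ∈ S → ∀ i, y i ∈ Q) :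
    lmarginal (fun _ : Fin n => unif) s (S.indicator 1) x ≤ unif Q ^ s.card := by
  have h1 : MeasurableSet {y : s → ℝ | Function.updateFinset x s y ∈ S} :=
    measurable_updateFinset hS
  have h2 : lmarginal (fun _ : Fin n => unif) s (S.indicator 1) x =
      (Measure.pi fun _ : s => unif) {y | Function.updateFinset x s y ∈ S} :=
    lintegral_indicator_one h1
  rw [h2]
  calc _ ≤ (Measure.pi fun _ : s => unif) (Set.univ.pi fun _ => Q) :=
        measure_mono fun y hy i _ => hSQ y hy i
    _ = _ := by rw [Measure.pi_pi]; simp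

theorem lmarginal_indicator_cube_eq {n : ℕ} {S : Set (Fin n → ℝ)} (hS : MeasurableSet S)
    (s : Finset (Fin n)) (x : Fin n → ℝ) (Q : Set ℝ)
    (hSQ : ∀ y : s → ℝ, Function.updateFinset x s y ∈ S ↔ ∀ i, y i ∈ Q) :
    lmarginal (fun _ : Fin n => unif) s (S.indicator 1) x = unif Q ^ s.card := by
  refine le_antisymm (lmarginal_indicator_cube hS s x Q fun y => (hSQ y).1) ?_
  have h1 : MeasurableSet {y : s → ℝ | Function.updateFinset x s y ∈ S} :=
    measurable_updateFinset hS
  have h2 : lmarginal (fun _ : Fin n => unif) s (S.indicator 1) x =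
      (Measure.pi fun _ : s => unif) {y | Function.updateFinset x s y ∈ S} :=
    lintegral_indicator_one h1
  rw [h2]
  calc _ = (Measure.pi fun _ : s => unif) (Set.univ.pi fun _ => Q) := by
        rw [Measure.pi_pi]; simp
    _ ≤ _ := measure_mono fun y hy => (hSQ y).2 fun i => hy i (Set.mem_univ _)

theorem locationLaw_lonely {n : ℕ} {B : Set ℝ} (hB : MeasurableSet B) (u : Fin n) :
    locationLaw n (lonely B u) = (1 - unif B) ^ (n - 1) := by
  rw [← lintegral_indicator_one (measurableSet_lonely hB u)]
  have h := lintegral_eq_of_lmarginal_eq (μ := fun _ : Fin n => unif) (Finset.univ.erase u)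
    (f := (lonely B u).indicator 1) (g := fun _ => (1 - unif B) ^ (n - 1))
    (measurable_one.indicator (measurableSet_lonely hB u)) measurable_const ?_
  · refine h.trans ?_
    simp
  · funext x
    have hQ : unif {z | Int.fract (z - x u) ∉ B} = 1 - unif B := by
      rw [← unif_fract_sub hB (x u)]
      exact prob_compl_eq_one_sub ((measurable_fract.comp (measurable_id.sub_const _)) hB)
    rw [lmarginal_indicator_cube_eq (measurableSet_lonely hB u) _ x
      {z | Int.fract (z - x u) ∉ B}, hQ]
    · simp [lmarginal]
    · intro y
      constructor
      · rintro h ⟨i, hi⟩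
        have := h i (Finset.ne_of_mem_erase hi)
        simpa [Function.updateFinset, hi] using this
      · intro h v hv
        simpa [Function.updateFinset, hv] using h ⟨v, by simp [hv]⟩

theorem locationLaw_fract_sub_mem {n : ℕ} {D : Set ℝ} (hD : MeasurableSet D) {u v : Fin n}
    (huv : u ≠ v) : locationLaw n {x | Int.fract (x v - x u) ∈ D} = unif D := by
  have hS := measurableSet_fract_sub (n := n) hD u v
  rw [← lintegral_indicator_one hS]
  have h := lintegral_eq_of_lmarginal_eq (μ := fun _ : Fin n => unif) {v}
    (f := {x : Fin n → ℝ | Int.fract (x v - x u) ∈ D}.indicator 1) (g := fun _ => unif D)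
    (measurable_one.indicator hS) measurable_const ?_
  · refine h.trans ?_
    simp
  · funext x
    rw [lmarginal_indicator_cube_eq hS _ x {z | Int.fract (z - x u) ∈ D}, unif_fract_sub hD]
    · simp [lmarginal]
    · intro y
      constructor
      · rintro h ⟨i, hi⟩
        obtain rfl := Finset.mem_singleton.1 hi
        simpa [Function.updateFinset, huv] using h
      · intro h
        simpa [Function.updateFinset, huv] using h ⟨v, by simp⟩

/-- Fix the locations of `u` and `v` and integrate out the rest. If the translates of `B` are
disjoint, each other vertex avoids both with probability `1 - 2 * unif B`. They can meet only if the
relative position of `v` lies in `D`, and then avoiding one translate is a sufficient bound. -/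
theorem locationLaw_lonely_inter_le {n : ℕ} {B D : Set ℝ} (hB : MeasurableSet B)
    (hD : MeasurableSet D)
    (hBD : ∀ y y' z : ℝ, Int.fract (z - y) ∈ B → Int.fract (z - y') ∈ B → Int.fract (y' - y) ∈ D)
    {u v : Fin n} (huv : u ≠ v) :
    locationLaw n (lonely B u ∩ lonely B v) ≤
      (1 - 2 * unif B) ^ (n - 2) + (1 - unif B) ^ (n - 2) * unif D := by
  have hS := (measurableSet_lonely hB u).inter (measurableSet_lonely hB v)
  set T : Set (Fin n → ℝ) := {x | Int.fract (x v - x u) ∈ D} with hT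
  have hTm : MeasurableSet T := measurableSet_fract_sub hD u v
  set s : Finset (Fin n) := (Finset.univ.erase u).erase v with hs
  have hscard : s.card = n - 2 := by
    rw [hs, Finset.card_erase_of_mem (by simp [huv.symm]), Finset.card_erase_of_mem (by simp),
      Finset.card_univ, Fintype.card_fin]
    omega
  have hfr : ∀ y, MeasurableSet {z : ℝ | Int.fract (z - y) ∈ B} := fun y =>
    (measurable_fract.comp (measurable_id.sub_const _)) hB
  set g : (Fin n → ℝ) → ENNReal := fun x =>
    (1 - 2 * unif B) ^ (n - 2) + (1 - unif B) ^ (n - 2) * T.indicator 1 x with hg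
  have hgm : Measurable g :=
    measurable_const.add ((measurable_one.indicator hTm).const_mul _)
  rw [← lintegral_indicator_one hS]
  refine (lintegral_le_of_lmarginal_le (μ := fun _ : Fin n => unif) s (g := g)
    (measurable_one.indicator hS) hgm fun x => ?_).trans (le_of_eq ?_)
  · have hgx : lmarginal (fun _ : Fin n => unif) s g x = g x := by
      have hu : u ∉ s := by simp [hs]
      have hv : v ∉ s := by simp [hs]
      have : ∀ y : s → ℝ, g (Function.updateFinset x s y) = g x := by
        intro y
        have hiff : Function.updateFinset x s y ∈ T ↔ x ∈ T := by
          simp [hT, Function.updateFinset, hu, hv]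
        by_cases h : x ∈ T
        · simp only [hg, Set.indicator_of_mem h, Set.indicator_of_mem (hiff.2 h), Pi.one_apply]
        · simp only [hg, Set.indicator_of_notMem h, Set.indicator_of_notMem (mt hiff.1 h)]
      simp [lmarginal, this]
    rw [hgx]
    refine (lmarginal_indicator_cube hS s x
      ({z | Int.fract (z - x u) ∈ B} ∪ {z | Int.fract (z - x v) ∈ B})ᶜ ?_).trans ?_
    · rintro y ⟨h1, h2⟩ ⟨i, hi⟩
      have hi' := hi
      simp only [hs, Finset.mem_erase, Finset.mem_univ, and_true] at hi'
      have h1' := h1 i hi'.2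
      have h2' := h2 i hi'.1
      have hu : u ∉ s := by simp [hs]
      have hv : v ∉ s := by simp [hs]
      simp only [Function.updateFinset, hi, hu, hv, dite_true, dite_false] at h1' h2'
      simp [h1', h2']
    · rw [hscard, prob_compl_eq_one_sub ((hfr _).union (hfr _)), hg]
      by_cases hx : x ∈ T
      · simp only [Set.indicator_of_mem hx, Pi.one_apply, mul_one]
        refine le_trans ?_ le_add_self
        have hle : unif B ≤ unif ({z | Int.fract (z - x u) ∈ B} ∪
            {z | Int.fract (z - x v) ∈ B}) := by
          rw [← unif_fract_sub hB (x u)]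
          exact measure_mono Set.subset_union_left
        exact pow_le_pow_left' (tsub_le_tsub_left hle 1) _
      · simp only [Set.indicator_of_notMem hx, mul_zero, add_zero]
        rw [measure_union ?_ (hfr _), unif_fract_sub hB, unif_fract_sub hB, two_mul]
        exact Set.disjoint_left.2 fun z h h' => hx (hBD _ _ _ h h')
  · have h1 : ∫⁻ x, g x ∂(Measure.pi fun _ : Fin n => unif) = ∫⁻ x, g x ∂(locationLaw n) := rfl
    rw [h1, hg, lintegral_add_left measurable_const,
      lintegral_const_mul _ (measurable_one.indicator hTm), lintegral_indicator_one hTm, hT,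
      locationLaw_fract_sub_mem hD huv]
    simp

/-- The number of lonely vertices. -/
noncomputable def lonelyCount {n : ℕ} (B : Set ℝ) (x : Fin n → ℝ) : ℝ :=
  ∑ u : Fin n, (lonely B u).indicator 1 x

theorem measurable_lonelyCount {n : ℕ} {B : Set ℝ} (hB : MeasurableSet B) :
    Measurable (lonelyCount (n := n) B) :=
  Finset.measurable_sum _ fun u _ => measurable_one.indicator (measurableSet_lonely hB u)

theorem lonelyCount_nonneg {n : ℕ} (B : Set ℝ) (x : Fin n → ℝ) : 0 ≤ lonelyCount B x :=
  Finset.sum_nonneg fun _ _ => Set.indicator_nonneg (fun _ _ => zero_le_one) _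

theorem memLp_lonelyCount {n : ℕ} {B : Set ℝ} (hB : MeasurableSet B) :
    MemLp (lonelyCount (n := n) B) 2 (locationLaw n) := by
  refine MemLp.of_bound (measurable_lonelyCount hB).aestronglyMeasurable n (ae_of_all _ fun x => ?_)
  rw [Real.norm_of_nonneg (lonelyCount_nonneg B x)]
  calc lonelyCount B x ≤ ∑ u : Fin n, (1 : ℝ) := Finset.sum_le_sum fun u _ =>
        Set.indicator_le_self' (fun _ _ => zero_le_one) x
    _ = n := by simp

theorem integral_lonelyCount {n : ℕ} {B : Set ℝ} (hB : MeasurableSet B) {s : ℝ} (hs0 : 0 ≤ s)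
    (hs1 : s ≤ 1) (hs : unif B = ENNReal.ofReal s) :
    ∫ x, lonelyCount B x ∂(locationLaw n) = n * (1 - s) ^ (n - 1) := by
  unfold lonelyCount
  have h1 : (1 : ENNReal) - ENNReal.ofReal s = ENNReal.ofReal (1 - s) := by
    rw [ENNReal.ofReal_sub _ hs0, ENNReal.ofReal_one]
  rw [integral_finsetSum]
  · have h2 : ∀ u : Fin n, ∫ x, (lonely B u).indicator 1 x ∂(locationLaw n) =
        (1 - s) ^ (n - 1) := by
      intro u
      rw [integral_indicator_one (measurableSet_lonely hB u), measureReal_def,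
        locationLaw_lonely hB, hs, h1, ENNReal.toReal_pow, ENNReal.toReal_ofReal (by linarith)]
    simp [h2]
  · exact fun u _ => (integrable_const 1).indicator (measurableSet_lonely hB u)

theorem integral_lonelyCount_sq_le {n : ℕ} {B D : Set ℝ} (hB : MeasurableSet B)
    (hD : MeasurableSet D)
    (hBD : ∀ y y' z : ℝ, Int.fract (z - y) ∈ B → Int.fract (z - y') ∈ B → Int.fract (y' - y) ∈ D)
    {s t : ℝ} (hs0 : 0 ≤ s) (hs1 : s ≤ 1 / 2) (hs : unif B = ENNReal.ofReal s) (ht0 : 0 ≤ t)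
    (ht : unif D ≤ ENNReal.ofReal t) :
    ∫ x, lonelyCount B x ^ 2 ∂(locationLaw n) ≤
      n * (1 - s) ^ (n - 1) + n ^ 2 * ((1 - s) ^ (2 * (n - 2)) + (1 - s) ^ (n - 2) * t) := by
  set q := (1 - s) ^ (2 * (n - 2)) + (1 - s) ^ (n - 2) * t with hq
  have hs2 : 0 ≤ 1 - s := by linarith
  have hq0 : 0 ≤ q := by positivity
  have hint : ∀ u v : Fin n, Integrable ((lonely B u ∩ lonely B v).indicator (1 : (Fin n → ℝ) → ℝ))
      (locationLaw n) := fun u v =>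
    (integrable_const 1).indicator ((measurableSet_lonely hB u).inter (measurableSet_lonely hB v))
  have hsq : ∀ x : Fin n → ℝ, lonelyCount B x ^ 2 =
      ∑ u : Fin n, ∑ v : Fin n, (lonely B u ∩ lonely B v).indicator (1 : (Fin n → ℝ) → ℝ) x := by
    intro x
    rw [sq, lonelyCount, Finset.sum_mul_sum]
    simp only [Set.inter_indicator_one, Pi.mul_apply]
  simp_rw [hsq]
  rw [integral_finsetSum _ fun u _ => integrable_finsetSum _ fun v _ => hint u v]
  simp_rw [integral_finsetSum _ fun v _ => hint _ v]
  have h1 : (1 : ENNReal) - ENNReal.ofReal s = ENNReal.ofReal (1 - s) := by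
    rw [ENNReal.ofReal_sub _ hs0, ENNReal.ofReal_one]
  have h2 : (1 : ENNReal) - 2 * ENNReal.ofReal s = ENNReal.ofReal (1 - 2 * s) := by
    rw [ENNReal.ofReal_sub _ (by positivity), ENNReal.ofReal_one,
      ENNReal.ofReal_mul (by norm_num), ENNReal.ofReal_ofNat]
  have hterm : ∀ u v : Fin n, ∫ x, (lonely B u ∩ lonely B v).indicator (1 : (Fin n → ℝ) → ℝ) x
      ∂(locationLaw n) ≤ (if u = v then (1 - s) ^ (n - 1) else 0) + q := by
    intro u v
    rw [integral_indicator_one ((measurableSet_lonely hB u).inter (measurableSet_lonely hB v)),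
      measureReal_def]
    split_ifs with huv
    · rw [huv, Set.inter_self, locationLaw_lonely hB, hs, h1, ENNReal.toReal_pow,
        ENNReal.toReal_ofReal (by linarith)]
      linarith
    · rw [zero_add]
      refine ENNReal.toReal_le_of_le_ofReal hq0
        ((locationLaw_lonely_inter_le hB hD hBD huv).trans ?_)
      rw [hs, h1, h2, hq, ENNReal.ofReal_add (by positivity) (by positivity),
        ENNReal.ofReal_mul (by positivity), ← ENNReal.ofReal_pow (by linarith),
        ← ENNReal.ofReal_pow (by linarith)]
      gcongr
      rw [pow_mul]
      gcongr
      · linarith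
      · nlinarith [sq_nonneg s]
  calc _ ≤ ∑ u : Fin n, ∑ v : Fin n, ((if u = v then (1 - s) ^ (n - 1) else 0) + q) :=
        Finset.sum_le_sum fun u _ => Finset.sum_le_sum fun v _ => hterm u v
    _ = _ := by
        simp only [Finset.sum_add_distrib, Finset.sum_ite_eq, Finset.mem_univ, if_true,
          Finset.sum_const, Finset.card_univ, Fintype.card_fin, nsmul_eq_mul]
        ring

/-- The second moment bound for the number of lonely vertices. -/
theorem locationLaw_lonelyCount_le {n : ℕ} (hn : 2 ≤ n) {B D : Set ℝ} (hB : MeasurableSet B)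
    (hD : MeasurableSet D)
    (hBD : ∀ y y' z : ℝ, Int.fract (z - y) ∈ B → Int.fract (z - y') ∈ B → Int.fract (y' - y) ∈ D)
    {s t : ℝ} (hs0 : 0 ≤ s) (hs1 : s ≤ 1 / 2) (hs : unif B = ENNReal.ofReal s) (ht0 : 0 ≤ t)
    (ht : unif D ≤ ENNReal.ofReal t) :
    locationLaw n {x | lonelyCount B x < n * (1 - s) ^ n / 2} ≤
      ENNReal.ofReal (4 * ((n * (1 - s) ^ n)⁻¹ + (((1 - s) ^ 2)⁻¹ - 1) + t * ((1 - s) ^ n)⁻¹)) := by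
  have hs2 : 0 < 1 - s := by linarith
  have hn0 : (0 : ℝ) < n := by positivity
  set l : ℝ := n * (1 - s) ^ (n - 1) with hl
  have hl0 : 0 < l := by positivity
  have hE := integral_lonelyCount (n := n) hB hs0 (by linarith) hs
  have hV := variance_eq_sub (memLp_lonelyCount (n := n) hB)
  have hE2 := integral_lonelyCount_sq_le (n := n) hB hD hBD hs0 hs1 hs ht0 ht
  have hle : n * (1 - s) ^ n ≤ l := by
    rw [hl]
    gcongr n * ?_
    exact pow_le_pow_of_le_one hs2.le (by linarith) (Nat.sub_le n 1)
  -- The threshold is at most half the mean `l`, so Chebyshev with deviation `l / 2` applies; this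
  -- is the source of the factor `4`.
  have hsub : {x : Fin n → ℝ | lonelyCount B x < n * (1 - s) ^ n / 2} ⊆
      {x | l / 2 ≤ |lonelyCount B x - ∫ x, lonelyCount B x ∂(locationLaw n)|} := by
    intro x hx
    simp only [Set.mem_ofPred_eq] at hx ⊢
    rw [hE, ← hl, abs_sub_comm]
    exact le_trans (by linarith) (le_abs_self _)
  refine (measure_mono hsub).trans ((meas_ge_le_variance_div_sq (memLp_lonelyCount hB)
    (by positivity)).trans (ENNReal.ofReal_le_ofReal ?_))
  rw [div_le_iff₀ (by positivity), hV, hE]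
  have hE2' : ∫ x, (lonelyCount B ^ 2) x ∂(locationLaw n) ≤ l +
      n ^ 2 * ((1 - s) ^ (2 * (n - 2)) + (1 - s) ^ (n - 2) * t) := hE2
  obtain ⟨k, rfl⟩ : ∃ k, n = k + 2 := ⟨n - 2, by omega⟩
  have e1 : k + 2 - 2 = k := rfl
  have e2 : k + 2 - 1 = k + 1 := rfl
  rw [e1] at hE2'
  rw [← hl]
  refine (sub_le_sub_right hE2' _).trans ?_
  have e3 : (4 * (((k + 2 : ℕ) * (1 - s) ^ (k + 2))⁻¹ + (((1 - s) ^ 2)⁻¹ - 1) +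
      t * ((1 - s) ^ (k + 2))⁻¹)) * (l / 2) ^ 2 =
      l * (1 - s)⁻¹ - l ^ 2 +
      (k + 2 : ℕ) ^ 2 * ((1 - s) ^ (2 * k) + (1 - s) ^ k * t) := by
    rw [hl, e2]
    field_simp
    ring
  rw [e3]
  have e4 : 1 ≤ (1 - s)⁻¹ := (one_le_inv₀ hs2).2 (by linarith)
  nlinarith

/-! ### Many lonely vertices with high probability -/

theorem tendsto_mul_exp_neg {c : ℝ} (hc : 0 < c) :
    Tendsto (fun n : ℕ => Real.log n * Real.exp (-(c * Real.log n))) atTop (𝓝 0) := by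
  have h1 : Tendsto (fun n : ℕ => c * Real.log n) atTop atTop :=
    tendsto_log_nat.const_mul_atTop hc
  have h2 := ((Real.tendsto_pow_mul_exp_neg_atTop_nhds_zero 1).comp h1).const_mul c⁻¹
  rw [mul_zero] at h2
  refine h2.congr fun n => ?_
  simp only [Function.comp, pow_one]
  field_simp

/-- For `β < γ < 1` the mean is at least `n ^ (1 - γ)`, far above `4 * log n`. In the variance
bound, pairs with overlapping neighbourhoods contribute relative to the squared mean only about
`(log n / n) * n ^ γ`, which tends to zero. -/
theorem tendsto_lonelyCount {β c : ℝ} (hβ0 : 0 ≤ β) (hβ : β < 1) (hc : 0 ≤ c) {B D : ℕ → Set ℝ}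
    (hB : ∀ n, MeasurableSet (B n)) (hD : ∀ n, MeasurableSet (D n))
    (hBD : ∀ᶠ n in atTop, ∀ y y' z : ℝ,
      Int.fract (z - y) ∈ B n → Int.fract (z - y') ∈ B n → Int.fract (y' - y) ∈ D n)
    (hs : ∀ᶠ n : ℕ in atTop, unif (B n) = ENNReal.ofReal (β * (Real.log n / n)))
    (ht : ∀ᶠ n : ℕ in atTop, unif (D n) ≤ ENNReal.ofReal (c * (Real.log n / n))) :
    Tendsto (fun n : ℕ => locationLaw n {x | lonelyCount (B n) x < (⌈4 * Real.log n⌉₊ : ℝ)})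
      atTop (𝓝 0) := by
  obtain ⟨γ, hγ1, hγ2⟩ := exists_between hβ
  have hγ0 : 0 < γ := hβ0.trans_lt hγ1
  set ε := 1 - γ with hε
  have hε0 : 0 < ε := by linarith
  have hlog : Tendsto (fun n : ℕ => β * (Real.log n / n)) atTop (𝓝 0) := by
    simpa using tendsto_log_div_nat.const_mul β
  have hexp : Tendsto (fun n : ℕ => Real.exp (-(ε * Real.log n))) atTop (𝓝 0) :=
    Real.tendsto_exp_neg_atTop_nhds_zero.comp (tendsto_log_nat.const_mul_atTop hε0)
  have hlim : Tendsto (fun n : ℕ => ENNReal.ofReal (4 * (Real.exp (-(ε * Real.log n)) +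
      (((1 - β * (Real.log n / n)) ^ 2)⁻¹ - 1) +
      c * (Real.log n * Real.exp (-(ε * Real.log n)))))) atTop (𝓝 0) := by
    rw [← ENNReal.ofReal_zero]
    refine ENNReal.tendsto_ofReal ?_
    have h1 : Tendsto (fun n : ℕ => ((1 - β * (Real.log n / n)) ^ 2)⁻¹ - 1) atTop (𝓝 0) := by
      have := (((hlog.const_sub 1).pow 2).inv₀ (by norm_num)).sub_const 1
      simpa using this
    simpa using ((hexp.add h1).add ((tendsto_mul_exp_neg hε0).const_mul c)).const_mul 4
  refine tendsto_of_tendsto_of_tendsto_of_le_of_le' tendsto_const_nhds hlim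
    (Eventually.of_forall fun _ => zero_le) ?_
  have hgrow : ∀ᶠ n : ℕ in atTop, Real.exp (-(ε * Real.log n)) * (2 * (4 * Real.log n + 1)) ≤ 1 := by
    have h := (((tendsto_mul_exp_neg hε0).const_mul 8).add (hexp.const_mul 2))
    rw [mul_zero, mul_zero, add_zero] at h
    filter_upwards [h.eventually_le_const one_pos] with n hn
    linarith
  filter_upwards [hBD, hs, ht, hgrow, eventually_ge_atTop 2,
    hlog.eventually_le_const (show (0 : ℝ) < 1 / 2 by norm_num),
    hlog.eventually_le_const (show 0 < 1 - β / γ by rw [sub_pos, div_lt_one hγ0]; exact hγ1),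
    tendsto_log_nat.eventually_ge_atTop 1] with n hBDn hsn htn hg hn hs1 hs2 hl
  have hn0 : (0 : ℝ) < n := by positivity
  set s := β * (Real.log n / n) with hsdef
  have hs0 : 0 ≤ s := by positivity
  have h1s : 0 < 1 - s := by linarith
  have hpow : Real.exp (-(γ * Real.log n)) ≤ (1 - s) ^ n := by
    -- This is the inequality `1 + t ≤ exp t` at `t = s / (1 - s)`. The loss from `s` to `s / (1 -
    -- s)` is absorbed by passing from `β` to `γ`.
    have h1 : Real.exp (-(s / (1 - s))) ≤ 1 - s := by
      rw [Real.exp_neg, inv_le_comm₀ (Real.exp_pos _) h1s]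
      have := Real.add_one_le_exp (s / (1 - s))
      have h2 : (1 - s)⁻¹ = s / (1 - s) + 1 := by field_simp; ring
      linarith
    calc Real.exp (-(γ * Real.log n)) ≤ Real.exp (-(s / (1 - s))) ^ n := by
          rw [← Real.exp_nat_mul, Real.exp_le_exp]
          have h3 : (n : ℝ) * s = β * Real.log n := by rw [hsdef]; field_simp
          have h4 : (n : ℝ) * (s / (1 - s)) ≤ γ * Real.log n := by
            rw [← mul_div_assoc, h3, div_le_iff₀ h1s]
            have h5 : β ≤ γ * (1 - s) := by
              have h6 : β / γ ≤ 1 - s := by linarith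
              rwa [div_le_iff₀ hγ0, mul_comm] at h6
            have := mul_le_mul_of_nonneg_right h5 (by linarith : 0 ≤ Real.log n)
            linarith
          linarith
      _ ≤ _ := by gcongr
  have hnexp : (n : ℝ) = Real.exp (Real.log n) := (Real.exp_log hn0).symm
  have hmul : Real.exp (ε * Real.log n) ≤ n * (1 - s) ^ n := by
    calc Real.exp (ε * Real.log n) = n * Real.exp (-(γ * Real.log n)) := by
          conv_rhs => rw [hnexp]
          rw [Real.log_exp, ← Real.exp_add, hε]
          congr 1; ring
      _ ≤ _ := by gcongr
  have hinv : (n * (1 - s) ^ n)⁻¹ ≤ Real.exp (-(ε * Real.log n)) := by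
    rw [Real.exp_neg]
    exact inv_anti₀ (Real.exp_pos _) hmul
  have hK : (⌈4 * Real.log n⌉₊ : ℝ) ≤ n * (1 - s) ^ n / 2 := by
    have h1 : (⌈4 * Real.log n⌉₊ : ℝ) < 4 * Real.log n + 1 :=
      Nat.ceil_lt_add_one (by linarith)
    rw [Real.exp_neg, inv_mul_le_iff₀ (Real.exp_pos _)] at hg
    linarith
  calc _ ≤ locationLaw n {x | lonelyCount (B n) x < n * (1 - s) ^ n / 2} :=
        measure_mono fun x hx => lt_of_lt_of_le hx hK
    _ ≤ _ := locationLaw_lonelyCount_le hn (hB n) (hD n) hBDn hs0 hs1 hsn (by positivity) htn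
    _ ≤ _ := by
        have e : c * (Real.log n / n) * ((1 - s) ^ n)⁻¹ ≤
            c * (Real.log n * Real.exp (-(ε * Real.log n))) := by
          rw [mul_assoc]
          refine mul_le_mul_of_nonneg_left ?_ hc
          calc Real.log n / n * ((1 - s) ^ n)⁻¹ = Real.log n * (n * (1 - s) ^ n)⁻¹ := by
                rw [mul_inv]; ring
            _ ≤ _ := by gcongr
        refine ENNReal.ofReal_le_ofReal ?_
        linarith

/-! ### Lonely vertices lie in different components -/

theorem fract_eq_or {y z : ℝ} (hy : y ∈ Set.Icc (0 : ℝ) 1) (hz : z ∈ Set.Icc (0 : ℝ) 1) :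
    (0 ≤ z - y ∧ z - y < 1 ∧ Int.fract (z - y) = z - y) ∨
      (z - y < 0 ∧ -1 ≤ z - y ∧ Int.fract (z - y) = z - y + 1 ) ∨
      (z - y = 1 ∧ Int.fract (z - y) = 0) := by
  obtain ⟨hy0, hy1⟩ := hy
  obtain ⟨hz0, hz1⟩ := hz
  rcases lt_or_ge (z - y) 0 with h | h
  · right; left
    refine ⟨h, by linarith, ?_⟩
    rw [← Int.fract_add_one, Int.fract_eq_self.2 ⟨by linarith, by linarith⟩]
  · rcases lt_or_ge (z - y) 1 with h1 | h1
    · left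
      exact ⟨h, h1, Int.fract_eq_self.2 ⟨h, h1⟩⟩
    · right; right
      have : z - y = 1 := by linarith
      exact ⟨this, by rw [this, Int.fract_one]⟩

theorem circDist_eq_min_fract {y z : ℝ} (hy : y ∈ Set.Icc (0 : ℝ) 1)
    (hz : z ∈ Set.Icc (0 : ℝ) 1) :
    circDist y z = min (Int.fract (z - y)) (1 - Int.fract (z - y)) := by
  unfold circDist
  rcases fract_eq_or hy hz with ⟨h1, h2, h⟩ | ⟨h1, h2, h⟩ | ⟨h1, h⟩
  · rw [h, abs_sub_comm, abs_of_nonneg h1]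
  · rw [h, abs_sub_comm, abs_of_neg h1, min_comm]
    congr 1 <;> ring
  · rw [h, abs_sub_comm, h1]
    simp

/-- The relative positions at circular distance in `[r₁, r₂]`. -/
def annulus (r₁ r₂ : ℝ) : Set ℝ := Set.Icc r₁ r₂ ∪ Set.Icc (1 - r₂) (1 - r₁)

theorem measurableSet_annulus (r₁ r₂ : ℝ) : MeasurableSet (annulus r₁ r₂) :=
  measurableSet_Icc.union measurableSet_Icc

theorem unif_Icc {c d : ℝ} (hc : 0 ≤ c) (hd : d ≤ 1) :
    unif (Set.Icc c d) = ENNReal.ofReal (d - c) := by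
  rw [unif, Measure.restrict_apply measurableSet_Icc,
    Set.inter_eq_self_of_subset_left (Set.Icc_subset_Icc hc hd), Real.volume_Icc]

theorem unif_annulus {r₁ r₂ : ℝ} (h₁ : 0 ≤ r₁) (h : r₁ ≤ r₂) (h₂ : r₂ < 1 / 2) :
    unif (annulus r₁ r₂) = ENNReal.ofReal (2 * (r₂ - r₁)) := by
  rw [annulus, measure_union _ measurableSet_Icc, unif_Icc h₁ (by linarith),
    unif_Icc (by linarith) (by linarith), ← ENNReal.ofReal_add (by linarith) (by linarith)]
  · congr 1; ring
  · exact Set.disjoint_left.2 fun z hz hz' => by linarith [hz.2, hz'.1]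

/-- The triangle inequality on the circle. It supplies the set `D` in the second moment bound. -/
theorem fract_mem_annulus_of_fract_mem {r y y' z : ℝ} (hr : r ≤ 1 / 2)
    (h : Int.fract (z - y) ∈ annulus 0 r) (h' : Int.fract (z - y') ∈ annulus 0 r) :
    Int.fract (y' - y) ∈ annulus 0 (2 * r) := by
  set p := Int.fract (z - y) with hp
  set q := Int.fract (z - y') with hq
  have hp1 : p < 1 := Int.fract_lt_one _
  have hq1 : q < 1 := Int.fract_lt_one _
  have hp0 : 0 ≤ p := Int.fract_nonneg _
  have hq0 : 0 ≤ q := Int.fract_nonneg _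
  have hpq : Int.fract (y' - y) = Int.fract (p - q) := by
    rw [Int.fract_eq_fract]
    refine ⟨⌊z - y⌋ - ⌊z - y'⌋, ?_⟩
    rw [hp, hq, Int.fract, Int.fract]
    push_cast
    ring
  have hcase : (0 ≤ p - q ∧ Int.fract (p - q) = p - q) ∨
      (p - q < 0 ∧ Int.fract (p - q) = p - q + 1) := by
    rcases lt_or_ge (p - q) 0 with h | h
    · right
      refine ⟨h, ?_⟩
      rw [← Int.fract_add_one, Int.fract_eq_self.2 ⟨by linarith, by linarith⟩]
    · left
      exact ⟨h, Int.fract_eq_self.2 ⟨h, by linarith⟩⟩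
  rw [hpq]
  simp only [annulus, Set.mem_union, Set.mem_Icc, sub_zero] at h h' ⊢
  rcases hcase with ⟨h0, he⟩ | ⟨h0, he⟩ <;> rw [he] <;> rcases h with h | h <;>
    rcases h' with h' | h'
  · left; constructor <;> linarith
  · left; constructor <;> linarith
  · right; constructor <;> linarith
  · left; constructor <;> linarith
  · right; constructor <;> linarith
  · left; constructor <;> linarith
  · right; constructor <;> linarith
  · right; constructor <;> linarith

open Classical in
/-- The lonely vertices. -/
noncomputable def lonelySet {n : ℕ} (B : Set ℝ) (x : Fin n → ℝ) : Finset (Fin n) :=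
  Finset.univ.filter fun u => x ∈ lonely B u

theorem mem_lonelySet {n : ℕ} {B : Set ℝ} {x : Fin n → ℝ} {u : Fin n} :
    u ∈ lonelySet B x ↔ ∀ v, v ≠ u → Int.fract (x v - x u) ∉ B := by
  classical
  exact Finset.mem_filter.trans (and_iff_right (Finset.mem_univ u))

theorem lonelyCount_eq_card {n : ℕ} (B : Set ℝ) (x : Fin n → ℝ) :
    lonelyCount B x = (lonelySet B x).card := by
  classical
  simp [lonelyCount, lonelySet, Set.indicator]

/-- A vertex that is lonely for the whole annulus is isolated, so no nontrivial walk leaves it. -/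
theorem separated_lonelySet_annulus {n : ℕ} {rs rd : ℝ} {x : Fin n → ℝ}
    (hx : ∀ u, x u ∈ Set.Icc (0 : ℝ) 1) :
    Separated rs rd x (lonelySet (annulus rd rs) x) := by
  intro u hu v _ huv
  by_contra hne
  rcases ((SimpleGraph.reachable_iff_reflTransGen _ _).1 huv).cases_head with h | ⟨w, hw, -⟩
  · exact hne h
  · obtain ⟨h1, h2, h3⟩ := hw
    refine (mem_lonelySet.1 hu) w (Ne.symm h1) ?_
    rw [circDist_eq_min_fract (hx u) (hx w)] at h2 h3
    rcases min_choice (Int.fract (x w - x u)) (1 - Int.fract (x w - x u)) with h | h <;>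
      rw [h] at h2 h3
    · left; exact ⟨h2, h3⟩
    · right; constructor <;> linarith

/-- A lonely vertex is followed by a gap longer than `rs`, which no edge can cross. Two such gaps
separate the circle into two arcs, each ending at one of the two vertices. -/
theorem separated_lonelySet_Icc {n : ℕ} {rs rd : ℝ} {x : Fin n → ℝ}
    (hx : ∀ u, x u ∈ Set.Icc (0 : ℝ) 1) (hs0 : 0 ≤ rs) (hs : rs < 1 / 2) :
    Separated rs rd x (lonelySet (Set.Icc 0 rs) x) := by
  have h1 : ∀ u ∈ lonelySet (Set.Icc 0 rs) x, ∀ v, v ≠ u →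
      ¬ (x u ≤ x v ∧ x v - x u ≤ rs) ∧ ¬ (x v - x u + 1 ≤ rs) := by
    intro u hu v hv
    have := mem_lonelySet.1 hu v hv
    rw [Set.mem_Icc] at this
    rcases fract_eq_or (hx u) (hx v) with ⟨h1, h2, h⟩ | ⟨h1, h2, h⟩ | ⟨h1, h⟩ <;> rw [h] at this
    · exact ⟨fun h' => this ⟨h1, h'.2⟩, fun h' => by linarith⟩
    · exact ⟨fun h' => by linarith, fun h' => this ⟨by linarith, h'⟩⟩
    · exact ⟨fun h' => by linarith, fun h' => by linarith⟩
  have h2 : ∀ u ∈ lonelySet (Set.Icc 0 rs) x, ∀ w ∈ lonelySet (Set.Icc 0 rs) x, x u < x w →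
      ¬ (vrg rd rs x).Reachable w u := by
    intro u hu w hw huw hr
    -- A walk from `w` stays in the arc after `u` up to `w`: an edge leaving it, directly or around
    -- the circle, would cross the gap after `u` or the gap after `w`.
    have key : ∀ z, Relation.ReflTransGen (vrg rd rs x).Adj w z → x u < x z ∧ x z ≤ x w := by
      intro z h
      induction h with
      | refl => exact ⟨huw, le_rfl⟩
      | @tail v z _ hvz ih =>
        obtain ⟨hne, -, hd⟩ := hvz
        obtain ⟨hv1, hv2⟩ := ih
        have hvu : v ≠ u := fun h => by rw [h] at hv1; exact lt_irrefl _ hv1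
        have a1 := (h1 u hu v hvu).1
        have hz0 := (hx z).1
        have hz1 := (hx z).2
        have hu0 := (hx u).1
        unfold circDist at hd
        by_contra hcon
        have hz : x z ≤ x u ∨ x w < x z := by
          by_contra hz
          push Not at hz
          exact hcon hz
        rcases hz with hz | hz
        · have hzw : z ≠ w := fun h => by rw [h] at hz; linarith
          have a2 := (h1 w hw z hzw).2
          rw [abs_of_pos (by linarith : 0 < x v - x z)] at hd
          rcases min_le_iff.1 hd with hd | hd
          · exact a1 ⟨hv1.le, by linarith⟩
          · exact a2 (by linarith)
        · have hzw : z ≠ w := fun h => by rw [h] at hz; linarith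
          have a2 := (h1 w hw z hzw).1
          rw [abs_of_neg (by linarith : x v - x z < 0)] at hd
          rcases min_le_iff.1 hd with hd | hd
          · exact a2 ⟨hz.le, by linarith⟩
          · exact a1 ⟨hv1.le, by linarith⟩
    exact lt_irrefl _ (key u ((SimpleGraph.reachable_iff_reflTransGen _ _).1 hr)).1
  intro u hu v hv huv
  by_contra hne
  rcases lt_trichotomy (x u) (x v) with h | h | h
  · exact h2 u hu v hv h huv.symm
  · exact (h1 u hu v (Ne.symm hne)).1 ⟨h.le, by linarith⟩
  · exact h2 v hv u hu h huv

/-! ### Impossibility below the threshold -/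

theorem tendsto_two_mul_div_two_pow :
    Tendsto (fun n : ℕ => ENNReal.ofReal (2 * n / 2 ^ ⌈4 * Real.log n⌉₊)) atTop (𝓝 0) := by
  rw [← ENNReal.ofReal_zero]
  refine ENNReal.tendsto_ofReal ?_
  have hlim : Tendsto (fun n : ℕ => 2 * Real.exp (-Real.log n)) atTop (𝓝 0) := by
    simpa using (Real.tendsto_exp_neg_atTop_nhds_zero.comp tendsto_log_nat).const_mul 2
  refine tendsto_of_tendsto_of_tendsto_of_le_of_le' tendsto_const_nhds hlim
    (Eventually.of_forall fun _ => by positivity) ?_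
  filter_upwards [eventually_gt_atTop 0, tendsto_log_nat.eventually_ge_atTop 0] with n hn hl
  have hn0 : (0 : ℝ) < n := by exact_mod_cast hn
  -- As `log 2 > 1 / 2`, having `4 * log n` components gives a factor of at least `n ^ 2`, which
  -- beats the factor `2 * n` from the counting bound.
  have h1 : Real.exp (2 * Real.log n) ≤ 2 ^ ⌈4 * Real.log n⌉₊ := by
    rw [← Real.rpow_natCast, Real.rpow_def_of_pos two_pos, Real.exp_le_exp]
    have h2 := Nat.le_ceil (4 * Real.log n)
    have h3 : 1 / 2 < Real.log 2 := by linarith [Real.log_two_gt_d9]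
    nlinarith
  rw [div_le_iff₀ (by positivity)]
  calc 2 * (n : ℝ) = 2 * Real.exp (-Real.log n) * Real.exp (2 * Real.log n) := by
        rw [mul_assoc, ← Real.exp_add]
        conv_lhs => rw [← Real.exp_log hn0]
        congr 2; ring
    _ ≤ _ := by gcongr

theorem tendsto_averageErrorProb_of_lonely {a b β : ℝ} (hab : b < a) (hβ0 : 0 ≤ β) (hβ : β < 1)
    (ha : 0 < a) {B : ℕ → Set ℝ} (hB : ∀ n, MeasurableSet (B n))
    (hBann : ∀ᶠ n in atTop, B n ⊆ annulus 0 (radius a n))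
    (hunif : ∀ᶠ n : ℕ in atTop, unif (B n) = ENNReal.ofReal (β * (Real.log n / n)))
    (hsep : ∀ᶠ n : ℕ in atTop, ∀ x : Fin n → ℝ, (∀ u, x u ∈ Set.Icc (0 : ℝ) 1) →
      Separated (radius a n) (radius b n) x (lonelySet (B n) x))
    (A : (m : ℕ) → Algorithm (2 * m)) (hA : ∀ m, IsMarkovKernel (A m)) :
    Tendsto (fun m : ℕ => averageErrorProb (radius a (2 * m)) (radius b (2 * m)) (A m))
      atTop (𝓝 1) := by
  have hr : ∀ (c : ℝ) (n : ℕ), radius c n = c * (Real.log n / n) := fun c n => by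
    rw [radius, mul_div_assoc]
  have hrlim : Tendsto (fun n : ℕ => radius a n) atTop (𝓝 0) := by
    simp_rw [hr]
    simpa using tendsto_log_div_nat.const_mul a
  have hfew := tendsto_lonelyCount (c := 4 * a) (D := fun n => annulus 0 (2 * radius a n))
    hβ0 hβ (by positivity) hB (fun n => measurableSet_annulus _ _)
    (by
      filter_upwards [hBann, hrlim.eventually_le_const (show (0 : ℝ) < 1 / 2 by norm_num)]
        with n hn hn2 y y' z h h'
      exact fract_mem_annulus_of_fract_mem hn2 (hn h) (hn h'))
    hunif
    (by
      filter_upwards [hrlim.eventually_lt_const (show (0 : ℝ) < 1 / 4 by norm_num),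
        tendsto_log_nat.eventually_ge_atTop 0] with n hn hl
      have h0 : 0 ≤ radius a n := by rw [hr]; positivity
      rw [unif_annulus le_rfl (by positivity) (by linarith), hr]
      exact ENNReal.ofReal_le_ofReal (by linarith))
  have hsum := tendsto_two_mul_div_two_pow.add hfew
  have hlim := (ENNReal.Tendsto.sub (tendsto_const_nhds (x := (1 : ENNReal))) hsum
    (Or.inl (by simp))).comp tendsto_two_mul
  rw [add_zero, tsub_zero] at hlim
  refine tendsto_of_tendsto_of_tendsto_of_le_of_le' hlim tendsto_const_nhds ?_
    (Eventually.of_forall fun m => averageErrorProb_le_one _ _ _)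
  filter_upwards [eventually_gt_atTop 0, tendsto_two_mul.eventually hsep] with m hm hsepm
  have hlog : 0 ≤ Real.log ((2 * m : ℕ) : ℝ) := Real.log_natCast_nonneg _
  have hle : radius b (2 * m) ≤ radius a (2 * m) := by
    rw [hr, hr]
    gcongr
  refine le_trans ?_ (one_sub_le_averageErrorProb hm hle (A m) ⌈4 * Real.log (2 * m : ℕ)⌉₊)
  refine tsub_le_tsub_left (add_le_add le_rfl (measure_mono_ae ?_)) _
  filter_upwards [ae_mem_Icc (2 * m)] with x hx hno
  change lonelyCount (B (2 * m)) x < _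
  rw [lonelyCount_eq_card]
  by_contra hcon
  push Not at hcon
  exact hno ⟨_, by exact_mod_cast hcon, hsepm x hx⟩

theorem tendsto_averageErrorProb {a b : ℝ} (hb : 0 ≤ b) (hab : b < a)
    (h : a - b < 1 / 2 ∨ a < 1)
    (A : (m : ℕ) → Algorithm (2 * m)) (hA : ∀ m, IsMarkovKernel (A m)) :
    Tendsto (fun m : ℕ => averageErrorProb (radius a (2 * m)) (radius b (2 * m)) (A m))
      atTop (𝓝 1) := by
  have ha : 0 < a := hb.trans_lt hab
  have hr : ∀ (c : ℝ) (n : ℕ), radius c n = c * (Real.log n / n) := fun c n => by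
    rw [radius, mul_div_assoc]
  have hnonneg : ∀ n : ℕ, 0 ≤ Real.log n / n := fun n =>
    div_nonneg (Real.log_natCast_nonneg n) n.cast_nonneg
  have hrlim : ∀ᶠ n : ℕ in atTop, radius a n < 1 / 2 := by
    simp_rw [hr]
    have := tendsto_log_div_nat.const_mul a
    rw [mul_zero] at this
    exact this.eventually_lt_const (by norm_num)
  -- The full annulus has measure `2 * (a - b) * log n / n` and detects isolated vertices; the
  -- one-sided interval has measure `a * log n / n` and detects long gaps.
  rcases h with h | h
  · refine tendsto_averageErrorProb_of_lonely (β := 2 * (a - b)) hab (by linarith) (by linarith) ha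
      (B := fun n => annulus (radius b n) (radius a n)) (fun n => measurableSet_annulus _ _)
      (Eventually.of_forall fun n => ?_) ?_ ?_ A hA
    · have h0 : 0 ≤ radius b n := by rw [hr]; exact mul_nonneg hb (hnonneg n)
      exact Set.union_subset_union (Set.Icc_subset_Icc_left h0)
        (Set.Icc_subset_Icc_right (by linarith))
    · filter_upwards [hrlim] with n hn
      rw [unif_annulus _ _ hn, hr, hr]
      · congr 1; ring
      · rw [hr]; exact mul_nonneg hb (hnonneg n)
      · rw [hr, hr]; exact mul_le_mul_of_nonneg_right hab.le (hnonneg n)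
    · exact Eventually.of_forall fun n x hx => separated_lonelySet_annulus hx
  · refine tendsto_averageErrorProb_of_lonely (β := a) hab ha.le h ha
      (B := fun n => Set.Icc 0 (radius a n)) (fun n => measurableSet_Icc)
      (Eventually.of_forall fun n => Set.subset_union_left) ?_ ?_ A hA
    · filter_upwards [hrlim] with n hn
      rw [unif_Icc le_rfl (by linarith), hr, sub_zero]
    · filter_upwards [hrlim] with n hn x hx
      have h0 : 0 ≤ radius a n := by rw [hr]; exact mul_nonneg ha.le (hnonneg n)
      exact separated_lonelySet_Icc hx h0 hn

end GeometricBlock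

theorem mainTheorem7 (a b : ℝ) (hb : 0 ≤ b) (hab : b < a) :
    ((a - b < 1 / 2 ∨ a < 1) →
      ∀ A : (m : ℕ) → GeometricBlock.Algorithm (2 * m),
        (∀ m, ProbabilityTheory.IsMarkovKernel (A m)) →
        Filter.Tendsto
          (fun m : ℕ => GeometricBlock.averageErrorProb
            (GeometricBlock.radius a (2 * m)) (GeometricBlock.radius b (2 * m)) (A m))
          Filter.atTop (nhds 1)) ∧
    ((1 / 2 < a - b ∧ 1 < a) →
      ∀ V₁ : (m : ℕ) → Finset (Fin (2 * m)), (∀ m, (V₁ m).card = m) →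
        Filter.Tendsto
          (fun m : ℕ => GeometricBlock.successProb
            (GeometricBlock.radius a (2 * m)) (GeometricBlock.radius b (2 * m))
            (GeometricBlock.propagation
              (GeometricBlock.radius a (2 * m)) (GeometricBlock.radius b (2 * m))) (V₁ m))
          Filter.atTop (nhds 1)) := by
  exact ⟨fun h A hA => GeometricBlock.tendsto_averageErrorProb hb hab h A hA,
    fun h V₁ _ => GeometricBlock.tendsto_successProb_propagation hb h.1 h.2 V₁⟩
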